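/- **Setting.** Let $\varepsilon\in(0,1]$, and let $X$ be a pure jump Lévy process with Lévy triplet $(\gamma_\nu,0,\nu)$, where $\nu(\{0\})=0$, $\nu(\mathbb R)=\infty$, $\int (x^2\wedge 1)\,\nu(dx)<\infty$ and $\nu(dx)=p(x)\,dx$, that is, $$\mathbb E e^{iuX_t}=\exp\Big(itu\gamma_\nu+t\int_{\mathbb R}\big(e^{iux}-1-iux\mathbf 1_{|x|<1}\big)\nu(dx)\Big),\qquad u\in\mathbb R,\ t\ge 0,$$ with $\gamma_\nu=\int_{|x|\le 1}x\,\nu(dx)$ if $\int_{|x|\le1}|x|\,\nu(dx)<\infty$ and $\gamma_\nu=0$ otherwise. Write $X_t=tb_\nu+X^S_t+X^B_t$, where $X^B$ is the compound Poisson process of the jumps of size larger than $\varepsilon$, $X^S$ is the centred martingale of the compensated jumps of size at most $\varepsilon$, so that $\mathbb E e^{iuX^S_t}=\exp\big(t\int_{|x|\le\varepsilon}(e^{iux}-1-iux)\,\nu(dx)\big)$, and $b_\nu=\int_{|x|\le\varepsilon}x\,\nu(dx)$ if $\int_{|x|\le 1}|x|\,\nu(dx)<\infty$, $b_\nu=-\int_{\varepsilon<|x|\le1}x\,\nu(dx)$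 otherwise. For $\Delta>0$ let $g_\Delta$ be the Lebesgue density of $X^S_\Delta+\Delta b_\nu$. For $M>0$ and $\alpha\in(0,2)$, write $g_\Delta\in\mathcal A_{M,\alpha}$ if $$\int_{[-\eta,\eta]}x^2p(x)\,dx\ge M\eta^{2-\alpha}\qquad\text{for all }0<\eta\le\varepsilon .$$ The observations are the $n$ independent increments $X_{i\Delta}-X_{(i-1)\Delta}$, $1\le i\le n$. Estimators $\hat g_\Delta$ are (jointly measurable) functions of the observations, which may also use the Lévy measure of the large jumps, $\nu$ restricted to $\mathbb R\setminus[-\varepsilon,\varepsilon]$. Put $\|h\|^2=\int_{\mathbb R}h(x)^2dx$ and $$F(\alpha)=\Big(\tfrac{2-\alpha}{\alpha}\cos\big(\tfrac{\pi\alpha}{2}\big)\Gamma(1-\alpha)\Big)^{-1}\ \ (\alpha\ne1),\qquad F(1)=\tfrac2\pi .$$ **Theorem (minimax lower bound).** Let $\alpha_0\in(0,2)$. There exist constants $c_0>0$ and $K>0$, depending only on $\alpha_0$, such that for all $0<M\le F(\alpha_0)$, all $\varepsilon\in(0,1]$, all $0<\Delta<e^{-4/(2-\alpha_0)}$ and all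 $n\in\mathbb N$ with $n\log^2(\Delta)\ge K$, $$\inf_{\hat g_\Delta}\ \sup_{g_\Delta\in\mathcal A_{M,\alpha_0}}\mathbb E\|\hat g_\Delta-g_\Delta\|^2\ \ge\ \frac{c_0}{n\Delta^{1/\alpha_0}},$$ where the infimum is over all estimators and the supremum is over all processes $X$ as above with $g_\Delta\in\mathcal A_{M,\alpha_0}$. -/

import Mathlib

open MeasureTheory Set
open scoped ENNReal

noncomputable section

/-- A Lévy measure on `ℝ` of infinite activity: no atom at `0`, infinite total mass and
`∫ (x² ∧ 1) ν(dx) < ∞`. -/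
structure IsInfiniteLevyMeasure (ν : Measure ℝ) : Prop where
  zero : ν {0} = 0
  infinite : ν univ = ∞
  lintegral_lt_top : ∫⁻ x, ENNReal.ofReal (min (x ^ 2) 1) ∂ν < ∞

/-- The small jumps have finite variation: `∫_{|x| ≤ 1} |x| ν(dx) < ∞`. -/
def FiniteVariationJumps (ν : Measure ℝ) : Prop :=
  ∫⁻ x in Icc (-1 : ℝ) 1, ENNReal.ofReal |x| ∂ν < ∞

open Classical in
/-- The drift `γ_ν` of the Lévy triplet `(γ_ν, 0, ν)`: it is `∫_{|x| ≤ 1} x ν(dx)` if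
`∫_{|x| ≤ 1} |x| ν(dx) < ∞`, and `0` otherwise. -/
def levyDrift (ν : Measure ℝ) : ℝ :=
  if FiniteVariationJumps ν then ∫ x in Icc (-1 : ℝ) 1, x ∂ν else 0

open Classical in
/-- The drift `b_ν` of the decomposition `X_t = t b_ν + X_t^S + X_t^B` at jump size `ε`. -/
def smallJumpDrift (ε : ℝ) (ν : Measure ℝ) : ℝ :=
  if FiniteVariationJumps ν then ∫ x in Icc (-ε) ε, x ∂ν
  else -∫ x in {x : ℝ | ε < |x| ∧ |x| ≤ 1}, x ∂ν

/-- `P` is the law of the increment `X_Δ` of the pure jump Lévy process with triplet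
`(γ_ν, 0, ν)` (Lévy-Khintchine formula). -/
structure IsIncrementLaw (ν : Measure ℝ) (Δ : ℝ) (P : Measure ℝ) : Prop where
  isProbabilityMeasure : IsProbabilityMeasure P
  charFun_eq : ∀ u : ℝ, charFun P u =
    Complex.exp (Complex.I * Δ * u * levyDrift ν +
      Δ * ∫ x, (Complex.exp (Complex.I * u * x) - 1 -
        {y : ℝ | |y| < 1}.indicator (fun y : ℝ => Complex.I * u * y) x) ∂ν)

/-- `g` is a Lebesgue density of `Z_Δ = X_Δ^S + Δ b_ν`, where `X^S` is the centred martingale of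
the compensated jumps of size at most `ε`, so that
`E exp(i u X_Δ^S) = exp (Δ ∫_{|x| ≤ ε} (exp(i u x) - 1 - i u x) ν(dx))`. -/
structure IsSmallJumpDensity (ε : ℝ) (ν : Measure ℝ) (Δ : ℝ) (g : ℝ → ℝ) : Prop where
  measurable : Measurable g
  nonneg : ∀ x, 0 ≤ g x
  isProbabilityMeasure :
    IsProbabilityMeasure (volume.withDensity (fun x => ENNReal.ofReal (g x)))
  charFun_eq : ∀ u : ℝ, charFun (volume.withDensity (fun x => ENNReal.ofReal (g x))) u =
    Complex.exp (Complex.I * u * (Δ * smallJumpDrift ε ν) +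
      Δ * ∫ x in Icc (-ε) ε,
        (Complex.exp (Complex.I * u * x) - 1 - Complex.I * u * x) ∂ν)

/-- The class `𝒜_{M,α}` (at jump size `ε`): infinite Lévy measures with a density `p` such that
`∫_{[-η,η]} x² p(x) dx ≥ M η^{2-α}` for all `0 < η ≤ ε`. -/
def OreyClass (ε M α : ℝ) : Set (Measure ℝ) :=
  {ν | IsInfiniteLevyMeasure ν ∧ ∃ p : ℝ → ℝ, Measurable p ∧ (∀ x, 0 ≤ p x) ∧
    ν = volume.withDensity (fun x => ENNReal.ofReal (p x)) ∧
    ∀ η : ℝ, 0 < η → η ≤ ε → M * η ^ (2 - α) ≤ ∫ x in Icc (-η) η, x ^ 2 * p x}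

/-- The Lévy measure of the large jumps, i.e. `ν` restricted to `ℝ \ [-ε, ε]`. -/
def largeJumpMeasure (ε : ℝ) (ν : Measure ℝ) : Measure ℝ :=
  ν.restrict (Icc (-ε) ε)ᶜ

/-- Estimators of a function on `ℝ` from `n` real observations. An estimator may use the Lévy
measure `κ` of the large jumps, as the deconvolution estimators do; `T κ x y` is the value at `y`
of the estimate computed from the observations `x`. Estimators based on the observations alone are
those that do not depend on `κ`. -/
def IsEstimator (n : ℕ) (T : Measure ℝ → (Fin n → ℝ) → ℝ → ℝ) : Prop :=
  ∀ κ : Measure ℝ, Measurable (Function.uncurry (T κ))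

/-- The integrated risk `E ‖ĝ - g‖²` of an estimate `ĝ` computed from `n` independent observations
with common law `P`. -/
def integratedRisk (n : ℕ) (P : Measure ℝ) (ghat : (Fin n → ℝ) → ℝ → ℝ) (g : ℝ → ℝ) : ℝ≥0∞ :=
  ∫⁻ x, (∫⁻ y : ℝ, ENNReal.ofReal ((ghat x y - g y) ^ 2) ∂volume)
    ∂(Measure.pi fun _ : Fin n => P)

/-- The minimax risk over `𝒜_{M,α}` for the estimation of the density of `Z_Δ` from `n` independent
increments distributed as `X_Δ`. For each `ν` in the class, the law `P` and (up to null sets) the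
density `g` are unique. -/
def minimaxRisk (n : ℕ) (Δ ε M α : ℝ) : ℝ≥0∞ :=
  ⨅ (T : Measure ℝ → (Fin n → ℝ) → ℝ → ℝ) (_ : IsEstimator n T),
    ⨆ (ν : Measure ℝ) (_ : ν ∈ OreyClass ε M α)
      (P : Measure ℝ) (_ : IsIncrementLaw ν Δ P)
      (g : ℝ → ℝ) (_ : IsSmallJumpDensity ε ν Δ g),
      integratedRisk n P (T (largeJumpMeasure ε ν)) g

open Classical in
/-- The bound `F(α)` on the constant `M`. -/
def stableConst (α : ℝ) : ℝ :=
  if α = 1 then 2 / Real.pi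
  else ((2 - α) / α * Real.cos (Real.pi * α / 2) * Real.Gamma (1 - α))⁻¹

end

/-! The bound is a two-point argument. Both hypotheses are symmetric Lévy processes with all jumps
in `[-ε, ε]`, so there is no drift, the large jumps carry no information, and `X_Δ` coincides with
`Z_Δ`. Over time `Δ` each has a truncated stable part, which secures membership in the Orey class,
and a finite-activity part with about `r` positive and `r` negative jumps of size about `h`. Under
the first hypothesis the numbers of positive and negative jumps are independent Poisson variables.
Under the second they have covariance `δ r`: with rate `δ r` a positive and a negative jump occur
together and merge into one jump, their difference. The marginal counts are unchanged, and the law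
is again infinitely divisible, with Lévy measure `(1 - δ) r (U + U(-·)) + δ r (U * U(-·))` in place
of `r (U + U(-·))`.

The two laws are hard to tell apart. Expanded in Charlier polynomials, the likelihood ratio of the
correlated pair of counts against the independent pair has terms of `L²` norm `δ ^ j`, whatever `r`
is, so its `χ²`-divergence is at most `(δ / (1 - δ)) ^ 2`. Observing the sum of the jumps instead of
the counts only decreases it (`exists_density_of_charFun`, `exists_density_of_correlated_jumps`).
With `δ` of order `n ^ (-1/2)`, `n` observations do not separate the hypotheses
(`half_le_lintegral_pi_add`).

The two densities nevertheless differ. The correlation multiplies the characteristic function by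
`exp (δ r |φ_U(u) - 1| ^ 2)`. As `U` lives on positive jumps, `|φ_U(u) - 1|` is of order `u h`, so
the exponent is of order `δ` at frequencies `u` of order `1 / w`, where `w ^ 2 = r h ^ 2`. There the
first characteristic function is bounded below. Testing `g₁ - g₀` against a Gaussian of width `w`
gives a squared `L²` distance of order at least `δ ^ 2 / w` (`le_lintegral_sub_sq_of_charFun`). The
choice `h = min ε (Δ ^ (1 / α))`, `r = Δ h ^ (-α)` ensures `w ≤ Δ ^ (1 / α)`, with constants free of
`ε`, `Δ` and `M`, and the bound `1 / (n Δ ^ (1 / α))` follows. -/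

noncomputable section

open ProbabilityTheory Filter Topology
open scoped NNReal

/-! ### Compound Poisson laws -/

/-- The convolution powers of a measure on `ℝ`. -/
def convPow (ρ : Measure ℝ) : ℕ → Measure ℝ
  | 0 => Measure.dirac 0
  | k + 1 => convPow ρ k ∗ ρ

instance convPow_isProbabilityMeasure (ρ : Measure ℝ) [IsProbabilityMeasure ρ] (k : ℕ) :
    IsProbabilityMeasure (convPow ρ k) := by
  induction k with
  | zero => exact Measure.dirac.isProbabilityMeasure
  | succ k ih => exact Measure.probabilitymeasure_of_probabilitymeasures_conv _ _

lemma charFun_convPow (ρ : Measure ℝ) [IsProbabilityMeasure ρ] (k : ℕ) (u : ℝ) :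
    charFun (convPow ρ k) u = charFun ρ u ^ k := by
  induction k with
  | zero => simp [convPow]
  | succ k ih => rw [convPow, charFun_conv, ih, pow_succ]

/-- The kernel `k ↦ ρ^{*k}`. -/
def jumpKernel (ρ : Measure ℝ) : Kernel ℕ ℝ := Kernel.ofFunOfCountable (convPow ρ)

lemma jumpKernel_apply (ρ : Measure ℝ) (k : ℕ) : jumpKernel ρ k = convPow ρ k := rfl

instance jumpKernel_isMarkovKernel (ρ : Measure ℝ) [IsProbabilityMeasure ρ] :
    IsMarkovKernel (jumpKernel ρ) :=
  ⟨fun k => convPow_isProbabilityMeasure ρ k⟩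

/-- The compound Poisson law with rate `r` and jump law `ρ`. -/
def compoundPoisson (r : ℝ≥0) (ρ : Measure ℝ) : Measure ℝ :=
  (poissonMeasure r ⊗ₘ jumpKernel ρ).map Prod.snd

instance compoundPoisson_isProbabilityMeasure (r : ℝ≥0) (ρ : Measure ℝ)
    [IsProbabilityMeasure ρ] : IsProbabilityMeasure (compoundPoisson r ρ) :=
  Measure.isProbabilityMeasure_map (by fun_prop)

lemma norm_cexp_real_mul_I (u x : ℝ) : ‖Complex.exp (u * x * Complex.I)‖ = 1 := by
  have := Complex.norm_exp_ofReal_mul_I (u * x)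
  push_cast at this
  exact this

lemma integrable_cexp {Ω : Type*} [MeasurableSpace Ω] (μ : Measure Ω) [IsFiniteMeasure μ] (u : ℝ)
    (X : Ω → ℝ) (hX : Measurable X) :
    Integrable (fun ω => Complex.exp (u * X ω * Complex.I)) μ := by
  refine Integrable.of_bound (C := 1) (by fun_prop) (ae_of_all _ fun ω => ?_)
  rw [norm_cexp_real_mul_I]

lemma integral_poissonMeasure_pow (r : ℝ≥0) (z : ℂ) :
    ∫ k, z ^ k ∂(poissonMeasure r) = Complex.exp (r * (z - 1)) := by
  rw [integral_poissonMeasure]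
  have h : ∀ k : ℕ, (Real.exp (-r) * r ^ k / (k.factorial : ℝ)) • z ^ k =
      Complex.exp (-r) * ((r * z) ^ k / (k.factorial : ℂ)) := by
    intro k
    rw [Complex.real_smul]
    push_cast
    ring
  simp_rw [h]
  rw [tsum_mul_left, ← congrFun (NormedSpace.exp_eq_tsum_div (𝔸 := ℂ)) (r * z),
    ← Complex.exp_eq_exp_ℂ, ← Complex.exp_add]
  congr 1
  ring

lemma charFun_compoundPoisson (r : ℝ≥0) (ρ : Measure ℝ) [IsProbabilityMeasure ρ] (u : ℝ) :
    charFun (compoundPoisson r ρ) u = Complex.exp (r * (charFun ρ u - 1)) := by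
  rw [charFun_apply_real, compoundPoisson, integral_map (by fun_prop) (by fun_prop),
    Measure.integral_compProd (integrable_cexp _ u _ measurable_snd), ← integral_poissonMeasure_pow]
  refine integral_congr_ae (ae_of_all _ fun k => ?_)
  simp only [jumpKernel_apply]
  rw [← charFun_convPow, charFun_apply_real]

/-- As soon as there is one jump, the sum has an absolutely continuous law. Only the event of no
jump, of probability `exp (-r)`, can charge a null set. -/
lemma compoundPoisson_apply_le (r : ℝ≥0) (ρ : Measure ℝ) [IsProbabilityMeasure ρ]
    (hρ : ρ ≪ volume) {s : Set ℝ} (hs : MeasurableSet s) (h0 : volume s = 0) :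
    compoundPoisson r ρ s ≤ ENNReal.ofReal (Real.exp (-r)) := by
  rw [compoundPoisson, Measure.map_apply measurable_snd hs,
    Measure.compProd_apply (measurable_snd hs)]
  have h : ∀ k : ℕ, jumpKernel ρ k (Prod.mk k ⁻¹' (Prod.snd ⁻¹' s)) ≤
      ({0} : Set ℕ).indicator 1 k := by
    intro k
    cases k with
    | zero => simpa [preimage_preimage] using (prob_le_one (μ := jumpKernel ρ 0) (s := s))
    | succ k =>
      have : (convPow ρ (k + 1)) s = 0 := Measure.conv_absolutelyContinuous hρ h0
      simpa [jumpKernel_apply, preimage_preimage] using this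
  refine (lintegral_mono h).trans ?_
  rw [lintegral_indicator_one (by measurability), poissonMeasure_singleton]
  simp

/-- A finite measure is the Lévy measure of some probability measure. -/
lemma exists_law_of_isFiniteMeasure (ν : Measure ℝ) [IsFiniteMeasure ν] (hν : ν ≪ volume) :
    ∃ P : Measure ℝ, IsProbabilityMeasure P ∧
      (∀ u : ℝ, charFun P u = Complex.exp (∫ x : ℝ, (Complex.exp (u * x * Complex.I) - 1) ∂ν)) ∧
      ∀ s, MeasurableSet s → volume s = 0 → P s ≤ ENNReal.ofReal (Real.exp (-ν.real univ)) := by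
  by_cases h : ν = 0
  · subst h
    exact ⟨Measure.dirac 0, inferInstance, fun u => by simp, fun s _ _ => by
      simpa using (prob_le_one (μ := Measure.dirac (0 : ℝ)) (s := s))⟩
  have : NeZero ν := ⟨h⟩
  have hm : ν univ ≠ 0 := by simpa using h
  have hm' : ν univ ≠ ∞ := measure_ne_top _ _
  let r : ℝ≥0 := (ν univ).toNNReal
  have hr : (r : ℝ) = ν.real univ := rfl
  let ρ : Measure ℝ := (ν univ)⁻¹ • ν
  have hρ : IsProbabilityMeasure ρ := ⟨by
    simp [ρ]⟩
  refine ⟨compoundPoisson r ρ, inferInstance, fun u => ?_, fun s hs h0 => ?_⟩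
  · rw [charFun_compoundPoisson, integral_sub (integrable_cexp ν u (fun x => x) measurable_id)
      (integrable_const _), charFun_apply_real]
    congr 1
    simp only [ρ, integral_smul_measure, ENNReal.toReal_inv, integral_const]
    have : ((ν univ).toReal : ℂ) ≠ 0 := by
      exact_mod_cast (ENNReal.toReal_pos hm hm').ne'
    rw [Complex.real_smul, mul_sub, Complex.real_smul, hr, measureReal_def]
    push_cast
    field_simp
    simp only [mul_comm, mul_left_comm]
  · refine (compoundPoisson_apply_le r ρ ?_ hs h0)
    exact (Measure.absolutelyContinuous_of_le_smul (c := (ν univ)⁻¹) le_rfl).trans hν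

/-! ### Symmetric Lévy measures with finite second moment -/

/-- Symmetric absolutely continuous measures on `ℝ` with finite second moment. -/
structure IsSymmJump (ν : Measure ℝ) : Prop where
  map_neg : ν.map (fun x => -x) = ν
  absolutelyContinuous : ν ≪ volume
  lintegral_sq : ∫⁻ x, ENNReal.ofReal (x ^ 2) ∂ν < ∞

namespace IsSymmJump

variable {ν μ : Measure ℝ}

lemma integral_comp_neg {E : Type*} [NormedAddCommGroup E] [NormedSpace ℝ E] (h : IsSymmJump ν)
    (f : ℝ → E) : ∫ x, f (-x) ∂ν = ∫ x, f x ∂ν := by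
  conv_rhs => rw [← h.map_neg]
  exact ((MeasurableEquiv.neg ℝ).measurableEmbedding.integral_map f).symm

lemma integrable_comp_neg {E : Type*} [NormedAddCommGroup E] (h : IsSymmJump ν)
    {f : ℝ → E} (hf : Integrable f ν) : Integrable (fun x => f (-x)) ν := by
  rw [← h.map_neg] at hf
  exact (MeasurableEquiv.neg ℝ).measurableEmbedding.integrable_map_iff.1 hf

/-- Only the even part of an integrand survives against a symmetric measure. This reduces every
Lévy-Khintchine exponent below to `∫ (cos (u x) - 1)`. -/
lemma integral_eq_ofReal (h : IsSymmJump ν) {f : ℝ → ℂ} {g : ℝ → ℝ} (hf : Integrable f ν)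
    (hfg : ∀ x, f x + f (-x) = 2 * g x) : ∫ x, f x ∂ν = ((∫ x, g x ∂ν : ℝ) : ℂ) := by
  have h1 : 2 * ∫ x, f x ∂ν = ∫ x, (f x + f (-x)) ∂ν := by
    rw [integral_add hf (h.integrable_comp_neg hf), h.integral_comp_neg, two_mul]
  simp_rw [hfg] at h1
  rw [integral_const_mul, integral_complex_ofReal] at h1
  exact mul_left_cancel₀ two_ne_zero h1

lemma integral_odd (h : IsSymmJump ν) {s : Set ℝ} (hs : MeasurableSet s)
    (hs' : ∀ x, -x ∈ s ↔ x ∈ s) : ∫ x in s, x ∂ν = 0 := by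
  rw [← integral_indicator hs]
  have := h.integral_comp_neg (s.indicator fun x => x)
  have h2 : (fun x => s.indicator (fun x => x) (-x)) = fun x => -(s.indicator (fun x : ℝ => x) x) := by
    ext x
    by_cases hx : x ∈ s
    · rw [indicator_of_mem hx, indicator_of_mem ((hs' x).2 hx)]
    · rw [indicator_of_notMem hx, indicator_of_notMem (fun h => hx ((hs' x).1 h)), neg_zero]
  rw [h2, integral_neg] at this
  linarith

lemma restrict (h : IsSymmJump ν) {s : Set ℝ} (hs : MeasurableSet s)
    (hs' : ∀ x, -x ∈ s ↔ x ∈ s) : IsSymmJump (ν.restrict s) := by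
  refine ⟨?_, Measure.absolutelyContinuous_restrict.trans h.absolutelyContinuous,
    (setLIntegral_le_lintegral _ _).trans_lt h.lintegral_sq⟩
  have hpre : (fun x : ℝ => -x) ⁻¹' s = s := by ext x; exact hs' x
  have := Measure.restrict_map (μ := ν) (f := fun x : ℝ => -x) measurable_neg hs
  rw [hpre, h.map_neg] at this
  exact this.symm

lemma add (h : IsSymmJump ν) (h' : IsSymmJump μ) : IsSymmJump (ν + μ) := by
  refine ⟨?_, h.absolutelyContinuous.add_left h'.absolutelyContinuous, ?_⟩
  · rw [Measure.map_add _ _ measurable_neg, h.map_neg, h'.map_neg]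
  · rw [lintegral_add_measure]
    exact ENNReal.add_lt_top.2 ⟨h.lintegral_sq, h'.lintegral_sq⟩

lemma smul (h : IsSymmJump ν) (c : ℝ≥0) : IsSymmJump (c • ν) := by
  refine ⟨?_, ?_, ?_⟩
  · rw [Measure.map_smul, h.map_neg]
  · exact (Measure.absolutelyContinuous_of_le_smul (c := (c : ℝ≥0∞)) le_rfl).trans
      h.absolutelyContinuous
  · rw [lintegral_smul_measure]
    exact ENNReal.mul_lt_top (by simp) h.lintegral_sq

lemma integrable_sq (h : IsSymmJump ν) : Integrable (fun x : ℝ => x ^ 2) ν := by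
  refine ⟨by fun_prop, ?_⟩
  rw [hasFiniteIntegral_iff_ofReal (ae_of_all _ fun x => sq_nonneg x)]
  exact h.lintegral_sq

lemma zero (h : IsSymmJump ν) : ν {0} = 0 := h.absolutelyContinuous (by simp)

lemma abs_cos_sub_one_le (t : ℝ) : |Real.cos t - 1| ≤ t ^ 2 / 2 := by
  rw [abs_sub_comm, abs_of_nonneg (by linarith [Real.cos_le_one t])]
  linarith [Real.one_sub_sq_div_two_le_cos (x := t)]

lemma integrable_cos_sub_one (h : IsSymmJump ν) (u : ℝ) :
    Integrable (fun x : ℝ => Real.cos (u * x) - 1) ν := by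
  refine (h.integrable_sq.const_mul (u ^ 2 / 2)).mono' (by fun_prop) (ae_of_all _ fun x => ?_)
  refine (abs_cos_sub_one_le _).trans_eq ?_
  ring

lemma measure_lt_abs_lt_top (h : IsSymmJump ν) {η : ℝ} (hη : 0 < η) : ν {x | η < |x|} < ∞ := by
  have h1 := meas_ge_le_lintegral_div (μ := ν) (f := fun x : ℝ => ENNReal.ofReal (x ^ 2))
    (ε := ENNReal.ofReal (η ^ 2)) (by fun_prop) (by simpa using hη.ne') (by simp)
  refine (measure_mono fun x hx => ?_).trans_lt (h1.trans_lt
    (ENNReal.div_lt_top h.lintegral_sq.ne (by simpa using hη.ne')))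
  simp only [mem_ofPred_eq] at hx ⊢
  refine ENNReal.ofReal_le_ofReal ?_
  rw [← sq_abs x]
  gcongr

lemma measurableSet_lt_abs (η : ℝ) : MeasurableSet {x : ℝ | η < |x|} :=
  measurableSet_lt measurable_const measurable_abs

lemma monotone_cutoff : Monotone fun n : ℕ => {x : ℝ | 1 / (n + 1 : ℝ) < |x|} := by
  intro m n hmn x hx
  have h : (m : ℝ) ≤ n := by exact_mod_cast hmn
  have h' : 1 / (n + 1 : ℝ) ≤ 1 / (m + 1 : ℝ) :=
    one_div_le_one_div_of_le (by positivity) (by linarith)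
  exact h'.trans_lt hx

lemma iUnion_cutoff : (⋃ n : ℕ, {x : ℝ | 1 / (n + 1 : ℝ) < |x|}) = {0}ᶜ := by
  ext x
  simp only [mem_iUnion, mem_ofPred_eq, mem_compl_iff, mem_singleton_iff]
  constructor
  · rintro ⟨n, hn⟩ rfl
    rw [abs_zero] at hn
    exact lt_asymm hn (by positivity)
  · intro hx
    exact exists_nat_one_div_lt (abs_pos.2 hx)

/-- The cut-off of the jumps of size at most `η` has a law. -/
lemma exists_law_lt_abs (h : IsSymmJump ν) {η : ℝ} (hη : 0 < η) :
    ∃ P : Measure ℝ, IsProbabilityMeasure P ∧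
      (∀ u : ℝ, charFun P u =
        Complex.exp ((∫ x in {x | η < |x|}, (Real.cos (u * x) - 1) ∂ν : ℝ) : ℂ)) ∧
      ∀ s, MeasurableSet s → volume s = 0 →
        P s ≤ ENNReal.ofReal (Real.exp (-ν.real {x | η < |x|})) := by
  have hr := h.restrict (measurableSet_lt_abs η) (fun x => by simp)
  have : IsFiniteMeasure (ν.restrict {x | η < |x|}) := ⟨by
    simpa using h.measure_lt_abs_lt_top hη⟩
  obtain ⟨P, h1, h2, h3⟩ := exists_law_of_isFiniteMeasure _ hr.absolutelyContinuous
  refine ⟨P, h1, fun u => ?_, fun s hs h0 => by simpa [measureReal_def] using h3 s hs h0⟩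
  rw [h2 u]
  congr 1
  refine hr.integral_eq_ofReal ((integrable_cexp _ u (fun x => x) measurable_id).sub (integrable_const _))
    fun x => ?_
  have hc : (Real.cos (u * x) : ℂ) = (Complex.exp (u * x * Complex.I) +
      Complex.exp (-(u * x) * Complex.I)) / 2 := by
    rw [Complex.ofReal_cos, Complex.cos]
    push_cast
    rfl
  push_cast at hc ⊢
  rw [hc]
  ring_nf

/-- Existence of the infinitely divisible law with Lévy measure `ν`. -/
lemma exists_law (h : IsSymmJump ν) :
    ∃ P : Measure ℝ, IsProbabilityMeasure P ∧
      ∀ u : ℝ, charFun P u = Complex.exp ((∫ x, (Real.cos (u * x) - 1) ∂ν : ℝ) : ℂ) := by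
  choose P hP hc _ using fun n : ℕ => h.exists_law_lt_abs (η := 1 / (n + 1 : ℝ)) (by positivity)
  let f : ℝ → ℂ := fun u => Complex.exp ((∫ x, (Real.cos (u * x) - 1) ∂ν : ℝ) : ℂ)
  have hlim : ∀ u, Tendsto (fun n => charFun (P n) u) atTop (𝓝 (f u)) := by
    intro u
    have h1 := tendsto_setIntegral_of_monotone (μ := ν)
      (f := fun x : ℝ => Real.cos (u * x) - 1) (fun n : ℕ => measurableSet_lt_abs (1 / (n + 1 : ℝ)))
      monotone_cutoff (h.integrable_cos_sub_one u).integrableOn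
    rw [iUnion_cutoff, setIntegral_eq_integral_of_forall_compl_eq_zero] at h1
    · simp_rw [hc]
      exact (Complex.continuous_exp.tendsto _).comp
        ((Complex.continuous_ofReal.tendsto _).comp h1)
    · intro x hx
      have : x = 0 := by simpa using hx
      simp [this]
  -- Continuity of the limit at `0` yields tightness of the truncated laws, as in Lévy's continuity
  -- theorem.
  have hcont : ContinuousAt f 0 := by
    refine Complex.continuous_exp.continuousAt.comp
      (Complex.continuous_ofReal.continuousAt.comp ?_)
    have h0 : (∫ x, (Real.cos (0 * x) - 1) ∂ν : ℝ) = 0 := by simp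
    rw [ContinuousAt, h0]
    have hb : ∀ u : ℝ, ‖∫ x, (Real.cos (u * x) - 1) ∂ν‖ ≤ u ^ 2 / 2 * ∫ x, x ^ 2 ∂ν := by
      intro u
      rw [← integral_const_mul]
      refine norm_integral_le_of_norm_le (h.integrable_sq.const_mul _) (ae_of_all _ fun x => ?_)
      refine (abs_cos_sub_one_le _).trans_eq ?_
      ring
    refine squeeze_zero_norm hb ?_
    have : Tendsto (fun u : ℝ => u ^ 2 / 2 * ∫ x, x ^ 2 ∂ν) (𝓝 0)
        (𝓝 ((0 : ℝ) ^ 2 / 2 * ∫ x, x ^ 2 ∂ν)) := Continuous.tendsto (by fun_prop) 0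
    simpa using this
  have htight := isTightMeasureSet_of_tendsto_charFun hcont hlim
  let μ' : ℕ → ProbabilityMeasure ℝ := fun n => ⟨P n, hP n⟩
  have hcomp : IsCompact (closure (range μ')) := by
    refine isCompact_closure_of_isTightMeasureSet ?_
    convert htight using 1
    ext m
    constructor
    · rintro ⟨_, ⟨n, rfl⟩, rfl⟩
      exact ⟨n, rfl⟩
    · rintro ⟨n, rfl⟩
      exact ⟨μ' n, ⟨n, rfl⟩, rfl⟩
  -- A cluster point along an ultrafilter replaces a convergent subsequence. Its characteristic
  -- function is `f` because the full sequence already converges pointwise.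
  let U : Ultrafilter ℕ := Ultrafilter.of atTop
  obtain ⟨P₀, -, hP₀⟩ := hcomp.ultrafilter_le_nhds (U.map μ') (by
    rw [le_principal_iff]
    exact mem_of_superset (Ultrafilter.mem_map.2 (univ_mem' fun n => mem_range_self n))
      subset_closure)
  refine ⟨P₀, inferInstance, fun u => ?_⟩
  have h1 : Tendsto μ' (U : Filter ℕ) (𝓝 P₀) := hP₀
  rw [ProbabilityMeasure.tendsto_iff_forall_integral_rclike_tendsto ℂ] at h1
  have h2 := h1 (BoundedContinuousFunction.innerProbChar u)
  simp_rw [← charFun_eq_integral_innerProbChar] at h2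
  exact tendsto_nhds_unique h2 ((hlim u).mono_left (Ultrafilter.of_le _))

/-- The law with an infinite absolutely continuous Lévy measure is absolutely continuous. -/
lemma law_absolutelyContinuous (h : IsSymmJump ν) (hinf : ν univ = ∞) {P : Measure ℝ}
    [IsProbabilityMeasure P]
    (hP : ∀ u : ℝ, charFun P u = Complex.exp ((∫ x, (Real.cos (u * x) - 1) ∂ν : ℝ) : ℂ)) :
    P ≪ volume := by
  refine Measure.AbsolutelyContinuous.mk fun s hs h0 => ?_
  have key : ∀ n : ℕ, P s ≤ ENNReal.ofReal (Real.exp (-ν.real {x | 1 / (n + 1 : ℝ) < |x|})) := by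
    intro n
    have hη : (0 : ℝ) < 1 / (n + 1 : ℝ) := by positivity
    obtain ⟨P₁, hP₁, hc₁, hn⟩ := h.exists_law_lt_abs hη
    obtain ⟨P₂, hP₂, hc₂⟩ := (h.restrict (measurableSet_lt_abs (1 / (n + 1 : ℝ))).compl
      (fun x => by simp)).exists_law
    -- Jumps above and below the cut-off are independent. Given the small ones, a null set is hit
    -- only if the compound Poisson part hits a translate of it, which has probability at most the
    -- exponential of minus its rate. The rate tends to infinity with the cut-off tending to `0`.
    have hconv : P = P₂ ∗ P₁ := by
      refine Measure.ext_of_charFun (funext fun u => ?_)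
      rw [charFun_conv, hP, hc₁, hc₂, ← Complex.exp_add, ← Complex.ofReal_add, add_comm,
        integral_add_compl (measurableSet_lt_abs _) (h.integrable_cos_sub_one u)]
    rw [hconv, ← lintegral_indicator_one hs, Measure.lintegral_conv (by measurability)]
    refine (lintegral_mono (g := fun _ => ENNReal.ofReal
      (Real.exp (-ν.real {x | 1 / (n + 1 : ℝ) < |x|}))) fun x => ?_).trans (by simp)
    have hm : MeasurableSet ((fun y => x + y) ⁻¹' s) := (measurable_const_add x) hs
    have : ∫⁻ y, s.indicator 1 (x + y) ∂P₁ = P₁ ((fun y => x + y) ⁻¹' s) := by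
      rw [← lintegral_indicator_one hm]
      rfl
    rw [this]
    exact hn _ hm (by rwa [measure_preimage_add])
  have hlim : Tendsto (fun n : ℕ => ν {x | 1 / (n + 1 : ℝ) < |x|}) atTop (𝓝 ∞) := by
    have := tendsto_measure_iUnion_atTop (μ := ν) monotone_cutoff
    rw [iUnion_cutoff] at this
    have h1 := measure_union_le (μ := ν) {0} {0}ᶜ
    rw [union_compl_self, h.zero, zero_add, hinf, top_le_iff] at h1
    rw [h1] at this
    exact this
  have hreal : Tendsto (fun n : ℕ => ν.real {x | 1 / (n + 1 : ℝ) < |x|}) atTop atTop := by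
    rw [tendsto_atTop]
    intro b
    have := (ENNReal.tendsto_nhds_top_iff_nnreal.1 hlim) b.toNNReal
    filter_upwards [this] with n hn
    have hfin := (h.measure_lt_abs_lt_top (η := 1 / (n + 1 : ℝ)) (by positivity)).ne
    rw [measureReal_def]
    refine (Real.le_coe_toNNReal b).trans ?_
    exact (ENNReal.toReal_mono hfin hn.le)
  have h3 : Tendsto (fun n : ℕ => ENNReal.ofReal
      (Real.exp (-ν.real {x | 1 / (n + 1 : ℝ) < |x|}))) atTop (𝓝 0) := by
    have := ENNReal.tendsto_ofReal (Real.tendsto_exp_neg_atTop_nhds_zero.comp hreal)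
    simpa using this
  exact le_antisymm (ge_of_tendsto' h3 key) (zero_le)

end IsSymmJump

/-! ### Charlier polynomials -/

/-- The Charlier polynomials of the Poisson law with mean `r`, normalised so that
`∑ j, charlier r j k * t ^ j / j! = exp (-t) * (1 + t / r) ^ k`. -/
def charlier (r : ℝ) : ℕ → ℕ → ℝ
  | 0, _ => 1
  | j + 1, k => k / r * charlier r j (k - 1) - charlier r j k

/-- Replacing `k` by `k + 1` multiplies the generating function `exp (-t) * (1 + t / r) ^ k` by `1 +
t / r`, so the difference is `t / r` times it: differencing lowers the degree by one. -/
lemma charlier_forward_difference {r : ℝ} (j k : ℕ) :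
    charlier r (j + 1) (k + 1) - charlier r (j + 1) k = (j + 1) / r * charlier r j k := by
  induction j generalizing k with
  | zero => simp only [charlier]; push_cast; ring
  | succ j ih =>
    have h1 := ih k
    have e1 : charlier r (j + 1 + 1) k =
        k / r * charlier r (j + 1) (k - 1) - charlier r (j + 1) k := rfl
    rw [charlier, e1]
    simp only [Nat.add_sub_cancel]
    -- At `k = 0` the truncated `k - 1` carries the factor `0`, and the recursion reduces to a
    -- change of sign.
    cases k with
    | zero =>
      have h2 : charlier r (j + 1) 0 = -charlier r j 0 := by simp [charlier]
      have h3 : charlier r j 0 = -charlier r (j + 1) 0 := by rw [h2, neg_neg]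
      rw [h3] at h1
      push_cast at h1 ⊢
      linear_combination -h1
    | succ m =>
      have h2 := ih m
      have h3 : charlier r (j + 1) (m + 1) =
        ((m + 1 : ℕ) : ℝ) / r * charlier r j (m + 1 - 1) - charlier r j (m + 1) := rfl
      simp only [Nat.add_sub_cancel] at h2 h3 ⊢
      push_cast at h1 h2 h3 ⊢
      linear_combination -h1 + (m + 1) / r * h2 - (j + 1) / r * h3

lemma abs_charlier_le {r : ℝ} (hr : 0 < r) (j k : ℕ) : |charlier r j k| ≤ (1 + k / r) ^ j := by
  induction j generalizing k with
  | zero => simp [charlier]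
  | succ j ih =>
    rw [charlier]
    have h0 : (0 : ℝ) ≤ k / r := by positivity
    have h1 : |charlier r j (k - 1)| ≤ (1 + k / r) ^ j := by
      refine (ih _).trans ?_
      have : ((k - 1 : ℕ) : ℝ) ≤ k := by exact_mod_cast Nat.sub_le k 1
      gcongr
    calc |k / r * charlier r j (k - 1) - charlier r j k|
        ≤ |k / r * charlier r j (k - 1)| + |charlier r j k| := abs_sub _ _
      _ ≤ k / r * (1 + k / r) ^ j + (1 + k / r) ^ j := by
          rw [abs_mul, abs_of_nonneg h0]
          gcongr
          exact ih k
      _ = (1 + k / r) ^ (j + 1) := by ring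

/-- From `x ^ j ≤ j! exp x`. Geometric growth in `k` is integrable against every Poisson law. -/
lemma abs_charlier_le_geometric {r : ℝ} (hr : 0 < r) (j k : ℕ) :
    |charlier r j k| ≤ (j.factorial * Real.exp 1) * Real.exp (1 / r) ^ k := by
  refine (abs_charlier_le hr j k).trans ?_
  have h := Real.pow_div_factorial_le_exp (1 + k / r) (by positivity) j
  rw [div_le_iff₀ (by positivity)] at h
  refine h.trans_eq ?_
  rw [Real.exp_add, ← Real.exp_nat_mul]
  ring_nf

section Poisson

variable {r : ℝ≥0}

lemma integrable_poissonMeasure_of_le_geometric {E : Type*} [NormedAddCommGroup E] {f : ℕ → E}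
    {C D : ℝ} (h : ∀ k, ‖f k‖ ≤ C * D ^ k) : Integrable f (poissonMeasure r) := by
  rw [integrable_poissonMeasure_iff]
  have hs : Summable fun k : ℕ => (Real.exp (-r) * C) * ((r * D) ^ k / k.factorial) :=
    (Real.summable_pow_div_factorial (r * D)).mul_left _
  refine Summable.of_nonneg_of_le (fun k => by positivity) (fun k => ?_) hs
  calc Real.exp (-r) * r ^ k / k.factorial * ‖f k‖
      ≤ Real.exp (-r) * r ^ k / k.factorial * (C * D ^ k) := by gcongr; exact h k
    _ = _ := by rw [mul_pow]; ring

/-- The size-biasing (Stein-Chen) identity of the Poisson law: the factor `k / r` turns the weight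
at `k` into the weight at `k - 1`. The series are reindexed term by term, so `H` need not be
integrable. -/
lemma integral_poissonMeasure_mul_id {E : Type*} [NormedAddCommGroup E] [NormedSpace ℝ E]
    [FiniteDimensional ℝ E] (hr : 0 < r) (H : ℕ → E) :
    ∫ k, ((k : ℝ) / r) • H k ∂(poissonMeasure r) = ∫ k, H (k + 1) ∂(poissonMeasure r) := by
  rw [integral_poissonMeasure, integral_poissonMeasure]
  rw [← (Nat.succ_injective).tsum_eq]
  · refine tsum_congr fun k => ?_
    have hr' : (r : ℝ) ≠ 0 := by exact_mod_cast hr.ne'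
    rw [smul_smul, Nat.succ_eq_add_one, Nat.factorial_succ]
    congr 1
    push_cast
    field_simp
    exact pow_succ' _ _
  · intro k hk
    cases k with
    | zero => simp at hk
    | succ k => exact ⟨k, rfl⟩

lemma integrable_charlier_mul (hr : 0 < r) (i j : ℕ) :
    Integrable (fun k => charlier r i k * charlier r j k) (poissonMeasure r) := by
  refine integrable_poissonMeasure_of_le_geometric
    (C := (i.factorial * Real.exp 1) * (j.factorial * Real.exp 1))
    (D := Real.exp (1 / r) * Real.exp (1 / r)) fun k => ?_
  rw [Real.norm_eq_abs, abs_mul, mul_pow, mul_mul_mul_comm]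
  exact mul_le_mul (abs_charlier_le_geometric (NNReal.coe_pos.2 hr) i k)
    (abs_charlier_le_geometric (NNReal.coe_pos.2 hr) j k) (abs_nonneg _) (by positivity)

lemma integrable_charlier_mul_succ (hr : 0 < r) (i j : ℕ) :
    Integrable (fun k => charlier r i k * charlier r j (k + 1)) (poissonMeasure r) := by
  refine integrable_poissonMeasure_of_le_geometric
    (C := (i.factorial * Real.exp 1) * ((j.factorial * Real.exp 1) * Real.exp (1 / r)))
    (D := Real.exp (1 / r) * Real.exp (1 / r)) fun k => ?_
  rw [Real.norm_eq_abs, abs_mul, mul_pow, mul_mul_mul_comm]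
  refine mul_le_mul (abs_charlier_le_geometric (NNReal.coe_pos.2 hr) i k) ?_ (abs_nonneg _) (by positivity)
  refine (abs_charlier_le_geometric (NNReal.coe_pos.2 hr) j (k + 1)).trans_eq ?_
  ring

lemma integrable_charlier_mul_pow (hr : 0 < r) (j : ℕ) (a : ℂ) :
    Integrable (fun k => (charlier r j k : ℂ) * a ^ k) (poissonMeasure r) := by
  refine integrable_poissonMeasure_of_le_geometric (C := j.factorial * Real.exp 1)
    (D := Real.exp (1 / r) * ‖a‖) fun k => ?_
  rw [norm_mul, Complex.norm_real, norm_pow, mul_pow, ← mul_assoc]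
  gcongr
  exact abs_charlier_le_geometric (NNReal.coe_pos.2 hr) j k

/-- By the recursion and size-biasing, going from `j` to `j + 1` subtracts the integral from `a`
times itself, which gives a factor `a - 1`. -/
lemma integral_charlier_mul_pow (hr : 0 < r) (j : ℕ) (a : ℂ) :
    ∫ k, (charlier r j k : ℂ) * a ^ k ∂(poissonMeasure r) =
      (a - 1) ^ j * Complex.exp (r * (a - 1)) := by
  induction j with
  | zero => simp [charlier, integral_poissonMeasure_pow]
  | succ j ih =>
    have h1 := integral_poissonMeasure_mul_id hr
      (fun k => (charlier r j (k - 1) : ℂ) * a ^ k)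
    have hi : Integrable (fun k : ℕ => ((k : ℝ) / r) • ((charlier r j (k - 1) : ℂ) * a ^ k))
        (poissonMeasure r) := by
      have := (integrable_charlier_mul_pow hr (j + 1) a).add (integrable_charlier_mul_pow hr j a)
      refine this.congr (ae_of_all _ fun k => ?_)
      simp only [Pi.add_apply, charlier, Complex.real_smul]
      push_cast
      ring
    have h2 : ∫ k, (charlier r (j + 1) k : ℂ) * a ^ k ∂(poissonMeasure r) =
        ∫ k : ℕ, ((k : ℝ) / r) • ((charlier r j (k - 1) : ℂ) * a ^ k) ∂(poissonMeasure r) -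
          ∫ k, (charlier r j k : ℂ) * a ^ k ∂(poissonMeasure r) := by
      rw [← integral_sub hi (integrable_charlier_mul_pow hr j a)]
      refine integral_congr_ae (ae_of_all _ fun k => ?_)
      simp only [charlier, Complex.real_smul]
      push_cast
      ring
    rw [h2, h1]
    simp only [Nat.add_sub_cancel]
    have h3 : ∀ k : ℕ, (charlier r j k : ℂ) * a ^ (k + 1) =
        a * ((charlier r j k : ℂ) * a ^ k) := fun k => by ring
    simp_rw [h3]
    rw [integral_const_mul, ih]
    ring

/-- Expanding one factor by the recursion and size-biasing leaves `charlier r j` times the forward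
difference of `charlier r (j + 1)`, hence the factor `(j + 1) / r`. Orthogonality is not needed,
since the expansion is later summed by the triangle inequality. -/
lemma integral_charlier_sq (hr : 0 < r) (j : ℕ) :
    ∫ k, charlier r j k * charlier r j k ∂(poissonMeasure r) = j.factorial / r ^ j := by
  have hr' : (r : ℝ) ≠ 0 := by exact_mod_cast hr.ne'
  induction j with
  | zero => simp [charlier]
  | succ j ih =>
    have h1 := integral_poissonMeasure_mul_id hr
      (fun k => charlier r j (k - 1) * charlier r (j + 1) k)
    have hi : Integrable (fun k : ℕ => ((k : ℝ) / r) •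
        (charlier r j (k - 1) * charlier r (j + 1) k)) (poissonMeasure r) := by
      have := (integrable_charlier_mul hr (j + 1) (j + 1)).add
        (integrable_charlier_mul hr j (j + 1))
      refine this.congr (ae_of_all _ fun k => ?_)
      simp only [Pi.add_apply, smul_eq_mul]
      nth_rewrite 1 [charlier]
      ring
    have h2 : ∫ k, charlier r (j + 1) k * charlier r (j + 1) k ∂(poissonMeasure r) =
        ∫ k : ℕ, ((k : ℝ) / r) • (charlier r j (k - 1) * charlier r (j + 1) k)
          ∂(poissonMeasure r) -
          ∫ k, charlier r j k * charlier r (j + 1) k ∂(poissonMeasure r) := by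
      rw [← integral_sub hi (integrable_charlier_mul hr j (j + 1))]
      refine integral_congr_ae (ae_of_all _ fun k => ?_)
      simp only [smul_eq_mul]
      nth_rewrite 1 [charlier]
      ring
    rw [h2, h1]
    simp only [Nat.add_sub_cancel]
    rw [← integral_sub (integrable_charlier_mul_succ hr j (j + 1))
      (integrable_charlier_mul hr j (j + 1))]
    have h3 : ∀ k : ℕ, charlier r j k * charlier r (j + 1) (k + 1) -
        charlier r j k * charlier r (j + 1) k =
        (j + 1) / r * (charlier r j k * charlier r j k) := fun k => by
      rw [← mul_sub, charlier_forward_difference]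
      ring
    simp_rw [h3]
    rw [integral_const_mul, ih, Nat.factorial_succ]
    push_cast
    field_simp
    exact pow_succ' _ _

end Poisson

/-! ### The likelihood ratio of correlated Poisson variables -/

/-- The terms of the Mehler-type expansion of the likelihood ratio between a pair of Poisson
variables of mean `r` with covariance `s` and an independent pair. -/
def mehlerTerm (r s : ℝ) (j : ℕ) (p : ℕ × ℕ) : ℝ :=
  s ^ j / j.factorial * (charlier r j p.1 * charlier r j p.2)

/-- The likelihood ratio between a pair of Poisson variables of mean `r` with covariance `s` and
an independent pair. -/
def mehlerKernel (r s : ℝ) (p : ℕ × ℕ) : ℝ := ∑' j, mehlerTerm r s j p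

section Mehler

variable {r : ℝ≥0} {δ : ℝ}

lemma summable_mehlerTerm {r : ℝ} (hr : 0 < r) (s : ℝ) (p : ℕ × ℕ) :
    Summable fun j => mehlerTerm r s j p := by
  refine Summable.of_norm_bounded (Real.summable_pow_div_factorial
    (|s| * ((1 + p.1 / r) * (1 + p.2 / r)))) fun j => ?_
  rw [mehlerTerm, Real.norm_eq_abs, abs_mul, abs_mul, abs_div, abs_pow, Nat.abs_cast, mul_pow,
    mul_pow, mul_div_right_comm]
  gcongr <;> exact abs_charlier_le hr j _

lemma measurable_mehlerTerm (r s : ℝ) (j : ℕ) : Measurable (mehlerTerm r s j) :=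
  measurable_of_countable _

lemma integrable_mehlerTerm_sq (hr : 0 < r) (s : ℝ) (j : ℕ) :
    Integrable (fun p => mehlerTerm r s j p ^ 2)
      ((poissonMeasure r).prod (poissonMeasure r)) := by
  have := ((integrable_charlier_mul hr j j).mul_prod (integrable_charlier_mul hr j j)).const_mul
    ((s ^ j / j.factorial) ^ 2)
  refine this.congr (ae_of_all _ fun p => ?_)
  simp only [mehlerTerm]
  ring

lemma integral_mehlerTerm_sq (hr : 0 < r) (j : ℕ) :
    ∫ p, mehlerTerm r (δ * r) j p ^ 2 ∂((poissonMeasure r).prod (poissonMeasure r)) =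
      (δ ^ j) ^ 2 := by
  have h : ∀ p : ℕ × ℕ, mehlerTerm r (δ * r) j p ^ 2 = ((δ * r) ^ j / j.factorial) ^ 2 *
      ((charlier r j p.1 * charlier r j p.1) * (charlier r j p.2 * charlier r j p.2)) := by
    intro p
    simp only [mehlerTerm]
    ring
  simp_rw [h]
  rw [integral_const_mul, integral_prod_mul (fun k => charlier r j k * charlier r j k)
    (fun k => charlier r j k * charlier r j k), integral_charlier_sq hr]
  have hr' : (r : ℝ) ≠ 0 := by exact_mod_cast hr.ne'
  have hf : (j.factorial : ℝ) ≠ 0 := by positivity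
  rw [mul_pow]
  field_simp

lemma integrable_mehlerTerm (hr : 0 < r) (s : ℝ) (j : ℕ) :
    Integrable (mehlerTerm r s j) ((poissonMeasure r).prod (poissonMeasure r)) :=
  ((memLp_two_iff_integrable_sq (measurable_mehlerTerm _ _ _).aestronglyMeasurable).2
    (integrable_mehlerTerm_sq hr s j)).integrable (by norm_num)

/-- The `L¹` norm is at most the `L²` norm `δ ^ j`, here through `2 |T| ≤ δ ^ j + T ^ 2 / δ ^ j`. -/
lemma integral_abs_mehlerTerm_le (hr : 0 < r) (hδ : 0 < δ) (j : ℕ) :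
    ∫ p, |mehlerTerm r (δ * r) j p| ∂((poissonMeasure r).prod (poissonMeasure r)) ≤ δ ^ j := by
  have hp : 0 < δ ^ j := by positivity
  have h : ∀ p, |mehlerTerm r (δ * r) j p| ≤
      δ ^ j / 2 + (2 * δ ^ j)⁻¹ * mehlerTerm r (δ * r) j p ^ 2 := by
    intro p
    have := sq_nonneg (|mehlerTerm r (δ * r) j p| - δ ^ j)
    rw [sub_sq, sq_abs] at this
    rw [← sub_nonneg]
    have h2 : δ ^ j / 2 + (2 * δ ^ j)⁻¹ * mehlerTerm r (δ * r) j p ^ 2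
        - |mehlerTerm r (δ * r) j p| = (2 * δ ^ j)⁻¹ * (mehlerTerm r (δ * r) j p ^ 2 -
          2 * |mehlerTerm r (δ * r) j p| * δ ^ j + (δ ^ j) ^ 2) := by
      field_simp
      ring
    rw [h2]
    positivity
  refine (integral_mono (g := fun p => δ ^ j / 2 +
    (2 * δ ^ j)⁻¹ * mehlerTerm r (δ * r) j p ^ 2) (integrable_mehlerTerm hr _ j).abs
    ((integrable_const _).add ((integrable_mehlerTerm_sq hr _ j).const_mul _)) h).trans_eq ?_
  rw [integral_add (integrable_const _) ((integrable_mehlerTerm_sq hr _ j).const_mul _),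
    integral_const_mul, integral_mehlerTerm_sq hr]
  simp
  field_simp
  ring

lemma mehlerTerm_mul_pow (s : ℝ) (a b : ℂ) (j : ℕ) (p : ℕ × ℕ) :
    (mehlerTerm r s j p : ℂ) * (a ^ p.1 * b ^ p.2) = ((s : ℂ) ^ j / j.factorial) *
      (((charlier r j p.1 : ℂ) * a ^ p.1) * ((charlier r j p.2 : ℂ) * b ^ p.2)) := by
  simp only [mehlerTerm]
  push_cast
  ring

/-- Each term factorises over the two counts, and summing over `j` gives an exponential series; the
`L¹` bounds `δ ^ j` allow the exchange. The result is the joint generating function of two Poisson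
variables of mean `r` sharing a Poisson component of mean `δ r`, which identifies the kernel as
their likelihood ratio without a proof that it is non-negative. -/
lemma integral_mehlerKernel_mul_pow (hr : 0 < r) (hδ : 0 < δ) (hδ' : δ < 1) {a b : ℂ}
    (ha : ‖a‖ ≤ 1) (hb : ‖b‖ ≤ 1) :
    ∫ p, (mehlerKernel r (δ * r) p : ℂ) * (a ^ p.1 * b ^ p.2)
        ∂((poissonMeasure r).prod (poissonMeasure r)) =
      Complex.exp (r * (a - 1)) * Complex.exp (r * (b - 1)) *
        Complex.exp (δ * r * (a - 1) * (b - 1)) := by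
  have hint : ∀ j, Integrable (fun p : ℕ × ℕ => (mehlerTerm r (δ * r) j p : ℂ) *
      (a ^ p.1 * b ^ p.2)) ((poissonMeasure r).prod (poissonMeasure r)) := by
    intro j
    simp_rw [mehlerTerm_mul_pow]
    exact ((integrable_charlier_mul_pow hr j a).mul_prod
      (integrable_charlier_mul_pow hr j b)).const_mul _
  have hle : ∀ j, ∫ p, ‖(mehlerTerm r (δ * r) j p : ℂ) * (a ^ p.1 * b ^ p.2)‖
      ∂((poissonMeasure r).prod (poissonMeasure r)) ≤ δ ^ j := by
    intro j
    refine (integral_mono (hint j).norm (integrable_mehlerTerm hr _ j).abs fun p => ?_).trans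
      (integral_abs_mehlerTerm_le hr hδ j)
    simp only [norm_mul, Complex.norm_real, Real.norm_eq_abs, norm_pow]
    refine mul_le_of_le_one_right (abs_nonneg _) ?_
    exact mul_le_one₀ (pow_le_one₀ (norm_nonneg _) ha) (by positivity)
      (pow_le_one₀ (norm_nonneg _) hb)
  have hsum := hasSum_integral_of_summable_integral_norm hint
    (Summable.of_nonneg_of_le (fun j => by positivity) hle
      (summable_geometric_of_lt_one hδ.le hδ'))
  have h1 : ∀ p : ℕ × ℕ, ∑' j, (mehlerTerm r (δ * r) j p : ℂ) * (a ^ p.1 * b ^ p.2) =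
      (mehlerKernel r (δ * r) p : ℂ) * (a ^ p.1 * b ^ p.2) := by
    intro p
    rw [tsum_mul_right, mehlerKernel, Complex.ofReal_tsum]
  simp_rw [h1] at hsum
  refine hsum.unique ?_
  have h2 : ∀ j, ∫ p, (mehlerTerm r (δ * r) j p : ℂ) * (a ^ p.1 * b ^ p.2)
      ∂((poissonMeasure r).prod (poissonMeasure r)) =
      Complex.exp (r * (a - 1)) * Complex.exp (r * (b - 1)) *
        ((δ * r * (a - 1) * (b - 1)) ^ j / j.factorial) := by
    intro j
    simp_rw [mehlerTerm_mul_pow]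
    rw [integral_const_mul, integral_prod_mul (fun k => (charlier r j k : ℂ) * a ^ k)
      (fun k => (charlier r j k : ℂ) * b ^ k), integral_charlier_mul_pow hr,
      integral_charlier_mul_pow hr, mul_pow, mul_pow]
    push_cast
    ring
  simp_rw [h2]
  refine HasSum.mul_left _ ?_
  rw [Complex.exp_eq_exp_ℂ]
  exact NormedSpace.expSeries_div_hasSum_exp _

/-- The term `j = 0` is the constant `1`, and the others have `L²` norms `δ ^ j`, of sum `δ / (1 -
δ)`. The triangle inequality is obtained for partial sums from Cauchy-Schwarz with weights `δ ^ (j +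
1)`, and Fatou's lemma passes to the limit. -/
lemma lintegral_mehlerKernel_sub_one_sq_le (hr : 0 < r) (hδ : 0 < δ) (hδ' : δ < 1) :
    ∫⁻ p, ENNReal.ofReal ((mehlerKernel r (δ * r) p - 1) ^ 2)
        ∂((poissonMeasure r).prod (poissonMeasure r)) ≤ ENNReal.ofReal ((δ / (1 - δ)) ^ 2) := by
  have hr' : (0 : ℝ) < r := by exact_mod_cast hr
  let S : ℕ → ℕ × ℕ → ℝ := fun J p => ∑ j ∈ Finset.range J, mehlerTerm r (δ * r) (j + 1) p
  have hlim : ∀ p, Tendsto (fun J => ENNReal.ofReal (S J p ^ 2)) atTop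
      (𝓝 (ENNReal.ofReal ((mehlerKernel r (δ * r) p - 1) ^ 2))) := by
    intro p
    refine ENNReal.tendsto_ofReal (Tendsto.pow ?_ 2)
    have hs := summable_mehlerTerm hr' (δ * r) p
    have h1 := ((summable_nat_add_iff 1).2 hs).hasSum.tendsto_sum_nat
    have h2 := hs.tsum_eq_zero_add
    have h3 : mehlerTerm r (δ * r) 0 p = 1 := by simp [mehlerTerm, charlier]
    rw [h3] at h2
    rw [mehlerKernel, h2, add_sub_cancel_left]
    exact h1
  have hgeo : ∀ J, ∑ j ∈ Finset.range J, δ ^ (j + 1) ≤ δ / (1 - δ) := by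
    intro J
    have h1 : Summable fun j : ℕ => δ ^ (j + 1) :=
      (summable_nat_add_iff 1).2 (summable_geometric_of_lt_one hδ.le hδ')
    refine (h1.sum_le_tsum _ fun j _ => by positivity).trans_eq ?_
    simp_rw [pow_succ']
    rw [tsum_mul_left, tsum_geometric_of_lt_one hδ.le hδ', div_eq_mul_inv]
  have hbound : ∀ J, ∫⁻ p, ENNReal.ofReal (S J p ^ 2)
      ∂((poissonMeasure r).prod (poissonMeasure r)) ≤ ENNReal.ofReal ((δ / (1 - δ)) ^ 2) := by
    intro J
    have hint : Integrable (fun p => (∑ j ∈ Finset.range J, δ ^ (j + 1)) *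
        ∑ j ∈ Finset.range J, (δ ^ (j + 1))⁻¹ * mehlerTerm r (δ * r) (j + 1) p ^ 2)
        ((poissonMeasure r).prod (poissonMeasure r)) :=
      (integrable_finsetSum _ fun j _ =>
        (integrable_mehlerTerm_sq hr _ (j + 1)).const_mul _).const_mul _
    calc ∫⁻ p, ENNReal.ofReal (S J p ^ 2) ∂((poissonMeasure r).prod (poissonMeasure r))
        ≤ ∫⁻ p, ENNReal.ofReal ((∑ j ∈ Finset.range J, δ ^ (j + 1)) *
            ∑ j ∈ Finset.range J, (δ ^ (j + 1))⁻¹ * mehlerTerm r (δ * r) (j + 1) p ^ 2)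
            ∂((poissonMeasure r).prod (poissonMeasure r)) := by
          refine lintegral_mono fun p => ENNReal.ofReal_le_ofReal ?_
          refine Finset.sum_sq_le_sum_mul_sum_of_sq_le_mul _ (fun j _ => by positivity)
            (fun j _ => by positivity) fun j _ => le_of_eq ?_
          field_simp
      _ = ENNReal.ofReal ((∑ j ∈ Finset.range J, δ ^ (j + 1)) ^ 2) := by
          rw [← ofReal_integral_eq_lintegral_ofReal hint (ae_of_all _ fun p => by positivity),
            integral_const_mul, integral_finsetSum _ fun j _ =>
              (integrable_mehlerTerm_sq hr _ (j + 1)).const_mul _, sq]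
          congr 2
          refine Finset.sum_congr rfl fun j _ => ?_
          rw [integral_const_mul, integral_mehlerTerm_sq hr]
          field_simp
      _ ≤ _ := by
          refine ENNReal.ofReal_le_ofReal ?_
          have := hgeo J
          have h0 : 0 ≤ ∑ j ∈ Finset.range J, δ ^ (j + 1) := by positivity
          gcongr
  calc ∫⁻ p, ENNReal.ofReal ((mehlerKernel r (δ * r) p - 1) ^ 2)
        ∂((poissonMeasure r).prod (poissonMeasure r))
      = ∫⁻ p, liminf (fun J => ENNReal.ofReal (S J p ^ 2)) atTop
        ∂((poissonMeasure r).prod (poissonMeasure r)) :=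
        lintegral_congr fun p => (hlim p).liminf_eq.symm
    _ ≤ liminf (fun J => ∫⁻ p, ENNReal.ofReal (S J p ^ 2)
        ∂((poissonMeasure r).prod (poissonMeasure r))) atTop :=
        lintegral_liminf_le fun J => measurable_of_countable _
    _ ≤ _ := (liminf_le_liminf (Eventually.of_forall hbound)).trans (by simp)

end Mehler

/-! ### Likelihood ratios of images -/

section Likelihood

variable {Ω : Type*} [MeasurableSpace Ω] {Q : Measure Ω}

lemma integral_map_withDensity_ofReal {E : Type*} [NormedAddCommGroup E] [NormedSpace ℝ E]
    {X : Ω → ℝ} (hX : Measurable X) {V : Ω → ℝ} (hV : Measurable V) {f : ℝ → E}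
    (hf : StronglyMeasurable f) :
    ∫ x, f x ∂((Q.withDensity fun ω => ENNReal.ofReal (V ω)).map X) =
      ∫ ω, max (V ω) 0 • f (X ω) ∂Q := by
  rw [integral_map hX.aemeasurable hf.aestronglyMeasurable,
    integral_withDensity_eq_integral_toReal_smul (by fun_prop) (by simp)]
  simp only [ENNReal.toReal_ofReal']

lemma integral_max_smul_sub {E : Type*} [NormedAddCommGroup E] [NormedSpace ℝ E]
    {V : Ω → ℝ} (hV : Integrable V Q) {f : Ω → E} {C : ℝ}
    (hf : AEStronglyMeasurable f Q) (hC : ∀ ω, ‖f ω‖ ≤ C) :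
    ∫ ω, V ω • f ω ∂Q = ∫ ω, max (V ω) 0 • f ω ∂Q - ∫ ω, max (-V ω) 0 • f ω ∂Q := by
  have i1 : Integrable (fun ω => max (V ω) 0 • f ω) Q :=
    hV.pos_part.smul_bdd C hf (ae_of_all _ hC)
  have i2 : Integrable (fun ω => max (-V ω) 0 • f ω) Q :=
    hV.neg_part.smul_bdd C hf (ae_of_all _ hC)
  rw [← integral_sub i1 i2]
  refine integral_congr_ae (ae_of_all _ fun ω => ?_)
  simp only [← sub_smul]
  congr 1
  rcases le_total (V ω) 0 with h | h <;> simp [h]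

/-- If the characteristic function of `P` is that of the image under `X` of the signed measure
`W • Q`, then `P` has a density with respect to the law of `X`, and its `χ²`-divergence from that
law is at most the variance of `W`. -/
lemma exists_density_of_charFun [IsProbabilityMeasure Q] {X W : Ω → ℝ} (hX : Measurable X) (hWm : Measurable W) {c : ℝ}
    (hW : ∫⁻ ω, ENNReal.ofReal ((W ω - 1) ^ 2) ∂Q ≤ ENNReal.ofReal c)
    {P : Measure ℝ} [IsProbabilityMeasure P]
    (hP : ∀ u : ℝ, charFun P u = ∫ ω, (W ω : ℂ) * Complex.exp (u * X ω * Complex.I) ∂Q) :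
    ∃ h : ℝ → ℝ, Measurable h ∧ (∀ x, 0 ≤ h x) ∧
      P = (Q.map X).withDensity (fun x => ENNReal.ofReal (h x)) ∧
      ∫⁻ x, ENNReal.ofReal ((h x - 1) ^ 2) ∂(Q.map X) ≤ ENNReal.ofReal c := by
  have : IsProbabilityMeasure (Q.map X) := Measure.isProbabilityMeasure_map hX.aemeasurable
  have hsq : Integrable (fun ω => (W ω - 1) ^ 2) Q := by
    refine ⟨by fun_prop, ?_⟩
    rw [hasFiniteIntegral_iff_ofReal (ae_of_all _ fun x => sq_nonneg _)]
    exact hW.trans_lt ENNReal.ofReal_lt_top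
  have hW1 : Integrable (fun ω => W ω - 1) Q :=
    ((memLp_two_iff_integrable_sq (by fun_prop)).2 hsq).integrable (by norm_num)
  have hWi : Integrable W Q := by
    refine (hW1.add (integrable_const (1 : ℝ))).congr (ae_of_all _ fun ω => ?_)
    simp
  -- The sign of `W` is not known, so the images of its positive and negative parts are compared
  -- through `P + μm = μp`.
  let μp := (Q.withDensity fun ω => ENNReal.ofReal (W ω)).map X
  let μm := (Q.withDensity fun ω => ENNReal.ofReal (-W ω)).map X
  have : IsFiniteMeasure (Q.withDensity fun ω => ENNReal.ofReal (W ω)) :=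
    isFiniteMeasure_withDensity_ofReal hWi.2
  have : IsFiniteMeasure (Q.withDensity fun ω => ENNReal.ofReal (-W ω)) :=
    isFiniteMeasure_withDensity_ofReal hWi.neg.2
  have : IsFiniteMeasure μp := Measure.isFiniteMeasure_map _ _
  have : IsFiniteMeasure μm := Measure.isFiniteMeasure_map _ _
  have hsum : P + μm = μp := by
    refine Measure.ext_of_charFun (funext fun u => ?_)
    have hsm : StronglyMeasurable fun x : ℝ => Complex.exp (u * x * Complex.I) := by fun_prop
    have h1 : charFun (P + μm) u = charFun P u + charFun μm u := by
      simp only [charFun_apply_real]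
      exact integral_add_measure (integrable_cexp _ u _ measurable_id)
        (integrable_cexp _ u _ measurable_id)
    rw [h1, hP, charFun_apply_real, charFun_apply_real,
      integral_map_withDensity_ofReal hX hWm hsm, integral_map_withDensity_ofReal (V := fun ω => -W ω) hX hWm.neg hsm]
    have h2 := integral_max_smul_sub (f := fun ω => Complex.exp (u * X ω * Complex.I)) (C := 1)
      hWi (by fun_prop) (fun ω => (norm_cexp_real_mul_I _ _).le)
    simp only [Complex.real_smul] at h2 ⊢
    rw [h2, sub_add_cancel]
  have hac : P ≪ Q.map X := by
    have h1 : μp ≪ Q.map X := (withDensity_absolutelyContinuous _ _).map hX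
    refine Measure.AbsolutelyContinuous.trans ?_ h1
    rw [← hsum]
    exact Measure.AbsolutelyContinuous.rfl.add_right _
  let h : ℝ → ℝ := fun x => (P.rnDeriv (Q.map X) x).toReal
  have hm : Measurable h := by fun_prop
  have h0 : ∀ x, 0 ≤ h x := fun x => ENNReal.toReal_nonneg
  have hd : P = (Q.map X).withDensity (fun x => ENNReal.ofReal (h x)) := by
    refine (Measure.withDensity_rnDeriv_eq _ _ hac).symm.trans (withDensity_congr_ae ?_)
    filter_upwards [P.rnDeriv_lt_top (Q.map X)] with x hx
    exact (ENNReal.ofReal_toReal hx.ne).symm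
  refine ⟨h, hm, h0, hd, ?_⟩
  have hhi : Integrable h (Q.map X) := Measure.integrable_toReal_rnDeriv
  have hhX : Integrable (fun ω => h (X ω)) Q := hhi.comp_measurable hX
  -- This says that `h ∘ X` is the conditional expectation of `W` given `X`, so `h - 1` should have
  -- the smaller `L²` norm.
  have key : ∀ (f : ℝ → ℝ) (C : ℝ), Measurable f → (∀ x, ‖f x‖ ≤ C) →
      ∫ ω, (h (X ω) - 1) * f (X ω) ∂Q = ∫ ω, (W ω - 1) * f (X ω) ∂Q := by
    intro f C hf hC
    have hfX : AEStronglyMeasurable (fun ω => f (X ω)) Q :=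
      (hf.comp hX).aestronglyMeasurable
    have hbX : ∀ᵐ ω ∂Q, ‖f (X ω)‖ ≤ C := ae_of_all _ fun ω => hC _
    have hfi : ∀ μ : Measure ℝ, IsFiniteMeasure μ → Integrable f μ := fun μ _ =>
      Integrable.of_bound hf.aestronglyMeasurable C (ae_of_all _ hC)
    have e1 : ∫ x, f x ∂P = ∫ ω, W ω * f (X ω) ∂Q := by
      have h1 : ∫ x, f x ∂P + ∫ x, f x ∂μm = ∫ x, f x ∂μp := by
        rw [← hsum, integral_add_measure (hfi _ inferInstance) (hfi _ inferInstance)]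
      have h2 := integral_max_smul_sub (f := fun ω => f (X ω)) hWi hfX (fun ω => hC (X ω))
      rw [integral_map_withDensity_ofReal hX hWm hf.stronglyMeasurable,
        integral_map_withDensity_ofReal (V := fun ω => -W ω) hX hWm.neg hf.stronglyMeasurable] at h1
      simp only [smul_eq_mul] at h1 h2
      rw [h2]
      linarith
    have e2 : ∫ x, f x ∂P = ∫ ω, h (X ω) * f (X ω) ∂Q := by
      rw [hd, integral_withDensity_eq_integral_toReal_smul (by fun_prop) (by simp),
        integral_map hX.aemeasurable (by fun_prop)]
      simp [h0]
    simp_rw [sub_mul, one_mul]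
    rw [integral_sub (hhX.mul_bdd (c := C) hfX hbX) (Integrable.of_bound hfX C hbX),
      integral_sub (hWi.mul_bdd (c := C) hfX hbX) (Integrable.of_bound hfX C hbX), ← e1, ← e2]
  -- Square integrability of `h` is not yet known, so the contraction is proved for a bounded
  -- truncation. Since `(h - 1) F = F ^ 2`, testing with `F` and using `2 a b ≤ a ^ 2 + b ^ 2`
  -- bounds its norm; Fatou's lemma removes the truncation.
  let F : ℕ → ℝ → ℝ := fun m => {x | h x ≤ m}.indicator fun x => h x - 1
  have hF : ∀ m, Measurable (F m) := fun m =>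
    (hm.sub_const 1).indicator (measurableSet_le hm measurable_const)
  have hFb : ∀ m x, ‖F m x‖ ≤ m + 1 := by
    intro m x
    by_cases hx : h x ≤ m
    · simp only [F, indicator_of_mem (show x ∈ {x | h x ≤ m} from hx)]
      rw [Real.norm_eq_abs, abs_le]
      constructor <;> linarith [h0 x, hx]
    · simp only [F, indicator_of_notMem (show x ∉ {x | h x ≤ m} from hx), norm_zero]
      positivity
  have hFsq : ∀ m x, (h x - 1) * F m x = F m x ^ 2 := by
    intro m x
    by_cases hx : h x ≤ m
    · simp only [F, indicator_of_mem (show x ∈ {x | h x ≤ m} from hx), sq]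
    · simp [F, indicator_of_notMem (show x ∉ {x | h x ≤ m} from hx)]
  have hbound : ∀ m, ∫⁻ x, ENNReal.ofReal (F m x ^ 2) ∂(Q.map X) ≤ ENNReal.ofReal c := by
    intro m
    have hFi : Integrable (fun ω => F m (X ω) ^ 2) Q := by
      refine Integrable.of_bound (((hF m).comp hX).pow_const 2).aestronglyMeasurable
        ((m + 1 : ℝ) ^ 2) (ae_of_all _ fun ω => ?_)
      rw [norm_pow]
      have := hFb m (X ω)
      gcongr
    have h1 := key (F m) (m + 1) (hF m) (hFb m)
    simp_rw [hFsq] at h1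
    have h2 : ∫ ω, (W ω - 1) * F m (X ω) ∂Q ≤
        ∫ ω, (1 / 2 * (W ω - 1) ^ 2 + 1 / 2 * F m (X ω) ^ 2) ∂Q := by
      refine integral_mono (hW1.mul_bdd (c := (m + 1 : ℝ)) ((hF m).comp hX).aestronglyMeasurable
        (ae_of_all _ fun ω => hFb m _)) ((hsq.const_mul _).add (hFi.const_mul _)) fun ω => ?_
      nlinarith [sq_nonneg (W ω - 1 - F m (X ω))]
    rw [integral_add (hsq.const_mul _) (hFi.const_mul _), integral_const_mul,
      integral_const_mul] at h2
    have h3 : ∫ ω, F m (X ω) ^ 2 ∂Q ≤ ∫ ω, (W ω - 1) ^ 2 ∂Q := by linarith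
    rw [lintegral_map (by have := hF m; fun_prop) hX,
      ← ofReal_integral_eq_lintegral_ofReal hFi (ae_of_all _ fun ω => sq_nonneg _)]
    refine (ENNReal.ofReal_le_ofReal h3).trans ?_
    rwa [ofReal_integral_eq_lintegral_ofReal hsq (ae_of_all _ fun ω => sq_nonneg _)]
  have hlim : ∀ x, Tendsto (fun m => ENNReal.ofReal (F m x ^ 2)) atTop
      (𝓝 (ENNReal.ofReal ((h x - 1) ^ 2))) := by
    intro x
    obtain ⟨m₀, hm₀⟩ := exists_nat_ge (h x)
    refine tendsto_const_nhds.congr' ?_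
    filter_upwards [eventually_ge_atTop m₀] with m hm
    have hx : h x ≤ m := hm₀.trans (by exact_mod_cast hm)
    simp only [F, indicator_of_mem (show x ∈ {x | h x ≤ m} from hx)]
  calc ∫⁻ x, ENNReal.ofReal ((h x - 1) ^ 2) ∂(Q.map X)
      = ∫⁻ x, liminf (fun m => ENNReal.ofReal (F m x ^ 2)) atTop ∂(Q.map X) :=
        lintegral_congr fun x => (hlim x).liminf_eq.symm
    _ ≤ liminf (fun m => ∫⁻ x, ENNReal.ofReal (F m x ^ 2) ∂(Q.map X)) atTop :=
        lintegral_liminf_le fun m => by have := hF m; fun_prop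
    _ ≤ _ := (liminf_le_liminf (Eventually.of_forall hbound)).trans (by simp)

end Likelihood

/-! ### The two-point method -/

lemma pi_withDensity_ofReal {n : ℕ} (P : Measure ℝ) [IsProbabilityMeasure P] {h : ℝ → ℝ}
    (h0 : ∀ x, 0 ≤ h x) (hi : Integrable h P) :
    Measure.pi (fun _ : Fin n => P.withDensity fun x => ENNReal.ofReal (h x)) =
      (Measure.pi fun _ : Fin n => P).withDensity fun x => ENNReal.ofReal (∏ i, h (x i)) := by
  have : IsFiniteMeasure (P.withDensity fun x => ENNReal.ofReal (h x)) :=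
    isFiniteMeasure_withDensity_ofReal hi.2
  refine Measure.pi_eq fun s hs => ?_
  have h1 : ∀ i, (P.withDensity fun x => ENNReal.ofReal (h x)) (s i) =
      ENNReal.ofReal (∫ x, (s i).indicator h x ∂P) := by
    intro i
    rw [withDensity_apply _ (hs i), integral_indicator (hs i),
      ofReal_integral_eq_lintegral_ofReal hi.integrableOn (ae_of_all _ h0)]
  have hpi : Integrable (fun x : Fin n → ℝ => ∏ i, h (x i)) (Measure.pi fun _ : Fin n => P) :=
    Integrable.fintype_prod fun _ => hi
  rw [withDensity_apply _ (MeasurableSet.univ_pi hs), ← ofReal_integral_eq_lintegral_ofReal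
    hpi.integrableOn (ae_of_all _ fun x => Finset.prod_nonneg fun i _ => h0 _)]
  simp_rw [h1]
  rw [← ENNReal.ofReal_prod_of_nonneg fun i _ => integral_nonneg fun x =>
    indicator_nonneg (fun x _ => h0 x) x, ← integral_fintype_prod_eq_prod,
    ← integral_indicator (MeasurableSet.univ_pi hs)]
  congr 1
  refine integral_congr_ae (ae_of_all _ fun x => ?_)
  simp only
  by_cases hx : x ∈ univ.pi s
  · rw [indicator_of_mem hx]
    exact Finset.prod_congr rfl fun i _ => (indicator_of_mem (hx i (mem_univ i)) _).symm
  · rw [indicator_of_notMem hx]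
    simp only [Set.mem_pi, mem_univ, true_imp_iff, not_forall] at hx
    obtain ⟨i, hi⟩ := hx
    exact (Finset.prod_eq_zero (Finset.mem_univ i) (indicator_of_notMem hi _)).symm

/-- Le Cam's two-point bound for `n` independent observations, under a bound on the
`χ²`-divergence of one observation. -/
lemma half_le_lintegral_pi_add {n : ℕ} (P : Measure ℝ) [IsProbabilityMeasure P] {h : ℝ → ℝ}
    (hm : Measurable h) (h0 : ∀ x, 0 ≤ h x) {χ : ℝ} (hχ0 : 0 ≤ χ)
    (hP : IsProbabilityMeasure (P.withDensity fun x => ENNReal.ofReal (h x)))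
    (hχ : ∫⁻ x, ENNReal.ofReal ((h x - 1) ^ 2) ∂P ≤ ENNReal.ofReal χ)
    (hn : (1 + χ) ^ n ≤ 5 / 4) {a b : (Fin n → ℝ) → ℝ≥0∞} (ha : Measurable a) (hb : Measurable b)
    {d : ℝ≥0∞} (hd : ∀ x, d ≤ a x + b x) :
    d / 2 ≤ ∫⁻ x, a x ∂(Measure.pi fun _ : Fin n => P) +
      ∫⁻ x, b x ∂(Measure.pi fun _ : Fin n => P.withDensity fun x => ENNReal.ofReal (h x)) := by
  have hsq : Integrable (fun x => (h x - 1) ^ 2) P := by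
    refine ⟨by fun_prop, ?_⟩
    rw [hasFiniteIntegral_iff_ofReal (ae_of_all _ fun x => sq_nonneg _)]
    exact hχ.trans_lt ENNReal.ofReal_lt_top
  have hi1 : Integrable (fun x => h x - 1) P :=
    ((memLp_two_iff_integrable_sq (by fun_prop)).2 hsq).integrable (by norm_num)
  have hi : Integrable h P := by
    refine (hi1.add (integrable_const (1 : ℝ))).congr (ae_of_all _ fun ω => ?_)
    simp
  have hmean : ∫ x, h x ∂P = 1 := by
    have h1 := hP.measure_univ
    rw [withDensity_apply _ MeasurableSet.univ, Measure.restrict_univ,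
      ← ofReal_integral_eq_lintegral_ofReal hi (ae_of_all _ h0)] at h1
    simpa using h1
  have hsq' : Integrable (fun x => h x ^ 2) P := by
    have := (hsq.add (hi.const_mul 2)).sub (integrable_const (1 : ℝ))
    refine this.congr (ae_of_all _ fun x => ?_)
    simp only [Pi.sub_apply, Pi.add_apply]
    ring
  have hsecond : ∫ x, h x ^ 2 ∂P ≤ 1 + χ := by
    have e1 : ∫ x, (h x - 1) ^ 2 ∂P = ∫ x, h x ^ 2 ∂P - 1 := by
      have : ∀ x, (h x - 1) ^ 2 = h x ^ 2 - (2 * h x - 1) := fun x => by ring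
      simp_rw [this]
      have i1 : Integrable (fun x => 2 * h x - 1) P := (hi.const_mul 2).sub (integrable_const _)
      rw [integral_sub hsq' i1, integral_sub (hi.const_mul 2) (integrable_const _), integral_const_mul, hmean]
      simp
      norm_num
    rw [← ofReal_integral_eq_lintegral_ofReal hsq (ae_of_all _ fun x => sq_nonneg _),
      ENNReal.ofReal_le_ofReal_iff hχ0] at hχ
    linarith
  let L : (Fin n → ℝ) → ℝ := fun x => ∏ i, h (x i)
  have hLm : Measurable L := by fun_prop
  have hL0 : ∀ x, 0 ≤ L x := fun x => Finset.prod_nonneg fun i _ => h0 _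
  let Pn := Measure.pi fun _ : Fin n => P
  have hLi : Integrable L Pn := Integrable.fintype_prod fun _ => hi
  have hLmean : ∫ x, L x ∂Pn = 1 := by
    rw [integral_fintype_prod_eq_pow h, hmean, one_pow]
  have hLsqi : Integrable (fun x => L x ^ 2) Pn := by
    simp only [L, ← Finset.prod_pow]
    exact Integrable.fintype_prod (f := fun _ x => h x ^ 2) fun _ => hsq'
  have hLsq : ∫ x, L x ^ 2 ∂Pn ≤ 5 / 4 := by
    simp only [L, ← Finset.prod_pow]
    rw [integral_fintype_prod_eq_pow fun x => h x ^ 2, Fintype.card_fin]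
    refine le_trans ?_ hn
    gcongr
  have hmin : 1 / 2 ≤ ∫ x, min 1 (L x) ∂Pn := by
    -- A quadratic minorant of `min 1 L` needs only the first two moments of `L`: it integrates to
    -- at least `2 - 1 / 4 - 5 / 4 = 1 / 2`.
    have hle : ∀ x, 2 * L x - 1 / 4 - L x ^ 2 ≤ min 1 (L x) := by
      intro x
      rcases le_total 1 (L x) with h | h
      · rw [min_eq_left h]
        nlinarith [sq_nonneg (L x - 1)]
      · rw [min_eq_right h]
        nlinarith [sq_nonneg (L x - 1 / 2)]
    have h2 := integral_mono (μ := Pn) (((hLi.const_mul 2).sub (integrable_const _)).sub hLsqi)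
      ((integrable_const 1).inf hLi) hle
    refine le_trans ?_ h2
    have e : ∫ x, (2 * L x - 1 / 4 - L x ^ 2) ∂Pn = 2 - 1 / 4 - ∫ x, L x ^ 2 ∂Pn := by
      have i1 : Integrable (fun x => 2 * L x - 1 / 4) Pn :=
        (hLi.const_mul 2).sub (integrable_const _)
      rw [integral_sub i1 hLsqi, integral_sub (hLi.const_mul 2) (integrable_const _), integral_const_mul, hLmean]
      simp
    have e' := e.ge
    refine le_trans ?_ e'
    linarith
  have hminl : (2 : ℝ≥0∞)⁻¹ ≤ ∫⁻ x, ENNReal.ofReal (min 1 (L x)) ∂Pn := by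
    have i1 : Integrable (fun x => min 1 (L x)) Pn := (integrable_const 1).inf hLi
    rw [← ofReal_integral_eq_lintegral_ofReal i1
      (ae_of_all _ fun x => le_min zero_le_one (hL0 x))]
    refine le_trans ?_ (ENNReal.ofReal_le_ofReal hmin)
    rw [one_div, ENNReal.ofReal_inv_of_pos two_pos, ENNReal.ofReal_ofNat]
  rw [pi_withDensity_ofReal P h0 hi, lintegral_withDensity_eq_lintegral_mul _ (by fun_prop) hb,
    ← lintegral_add_left ha, div_eq_mul_inv]
  calc d * 2⁻¹ ≤ d * ∫⁻ x, ENNReal.ofReal (min 1 (L x)) ∂Pn := by gcongr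
    _ = ∫⁻ x, d * ENNReal.ofReal (min 1 (L x)) ∂Pn :=
        (lintegral_const_mul _ (by fun_prop)).symm
    _ ≤ _ := by
        refine lintegral_mono fun x => ?_
        calc d * ENNReal.ofReal (min 1 (L x))
            ≤ (a x + b x) * ENNReal.ofReal (min 1 (L x)) := by gcongr; exact hd x
          _ = a x * ENNReal.ofReal (min 1 (L x)) + b x * ENNReal.ofReal (min 1 (L x)) :=
              add_mul _ _ _
          _ ≤ a x * 1 + b x * ENNReal.ofReal (L x) := by
              gcongr
              · exact ENNReal.ofReal_le_one.2 (min_le_left _ _)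
              · exact min_le_right _ _
          _ = a x + ((fun y : Fin n → ℝ => ENNReal.ofReal (∏ i, h (y i))) * b) x := by
              rw [mul_one, mul_comm (b x)]
              rfl

/-! ### Correlating the positive and the negative jumps -/

/-- Correlating the numbers of jumps of two compound Poisson components of mean number of jumps `r`
by `δ` changes the law by at most `(δ / (1 - δ)) ^ 2` in `χ²`-divergence. -/
lemma exists_density_of_correlated_jumps {r : ℝ≥0} (hr : 0 < r) {δ : ℝ} (hδ : 0 < δ) (hδ' : δ < 1)
    (ρ₁ ρ₂ R P₀ P₁ : Measure ℝ) [IsProbabilityMeasure ρ₁] [IsProbabilityMeasure ρ₂]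
    [IsProbabilityMeasure R] [IsProbabilityMeasure P₀] [IsProbabilityMeasure P₁]
    (h₀ : ∀ u, charFun P₀ u = charFun R u *
      (Complex.exp (r * (charFun ρ₁ u - 1)) * Complex.exp (r * (charFun ρ₂ u - 1))))
    (h₁ : ∀ u, charFun P₁ u = charFun P₀ u *
      Complex.exp (δ * r * (charFun ρ₁ u - 1) * (charFun ρ₂ u - 1))) :
    ∃ h : ℝ → ℝ, Measurable h ∧ (∀ x, 0 ≤ h x) ∧
      P₁ = P₀.withDensity (fun x => ENNReal.ofReal (h x)) ∧
      ∫⁻ x, ENNReal.ofReal ((h x - 1) ^ 2) ∂P₀ ≤ ENNReal.ofReal ((δ / (1 - δ)) ^ 2) := by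
  -- The sample space records the two jump counts and, given them, the total displacement, with `R`
  -- the law of the remaining jumps. The likelihood ratio depends on the counts only, while the
  -- observation is the displacement.
  let κ : Kernel (ℕ × ℕ) ℝ :=
    Kernel.ofFunOfCountable fun p => R ∗ (convPow ρ₁ p.1 ∗ convPow ρ₂ p.2)
  have hκ : ∀ p, κ p = R ∗ (convPow ρ₁ p.1 ∗ convPow ρ₂ p.2) := fun p => rfl
  have : IsMarkovKernel κ := ⟨fun p => by rw [hκ]; infer_instance⟩
  have hκc : ∀ p u, charFun (κ p) u =
      charFun R u * (charFun ρ₁ u ^ p.1 * charFun ρ₂ u ^ p.2) := by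
    intro p u
    rw [hκ, charFun_conv, charFun_conv, charFun_convPow, charFun_convPow]
  let μ := (poissonMeasure r).prod (poissonMeasure r)
  let Q := μ ⊗ₘ κ
  have hQfst : Q.map Prod.fst = μ := Measure.fst_compProd μ κ
  let W : (ℕ × ℕ) × ℝ → ℝ := fun ω => mehlerKernel r (δ * r) ω.1
  have hKm : Measurable (mehlerKernel r (δ * r)) := measurable_of_countable _
  have hWm : Measurable W := hKm.comp measurable_fst
  have hWb : ∫⁻ ω, ENNReal.ofReal ((W ω - 1) ^ 2) ∂Q ≤ ENNReal.ofReal ((δ / (1 - δ)) ^ 2) := by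
    have h1 := lintegral_mehlerKernel_sub_one_sq_le hr hδ hδ'
    change ∫⁻ p, ENNReal.ofReal ((mehlerKernel r (δ * r) p - 1) ^ 2) ∂μ ≤ _ at h1
    rwa [← hQfst, lintegral_map (by fun_prop) measurable_fst] at h1
  have hWi : Integrable W Q := by
    have hsq : Integrable (fun ω => (W ω - 1) ^ 2) Q := by
      refine ⟨by fun_prop, ?_⟩
      rw [hasFiniteIntegral_iff_ofReal (ae_of_all _ fun x => sq_nonneg _)]
      exact hWb.trans_lt ENNReal.ofReal_lt_top
    have hW1 : Integrable (fun ω => W ω - 1) Q :=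
      ((memLp_two_iff_integrable_sq (by fun_prop)).2 hsq).integrable (by norm_num)
    refine (hW1.add (integrable_const (1 : ℝ))).congr (ae_of_all _ fun ω => ?_)
    simp
  have hP₀ : Q.map Prod.snd = P₀ := by
    have : IsProbabilityMeasure (Q.map Prod.snd) :=
      Measure.isProbabilityMeasure_map (by fun_prop)
    refine Measure.ext_of_charFun (funext fun u => ?_)
    rw [charFun_apply_real, integral_map (by fun_prop) (by fun_prop),
      Measure.integral_compProd (integrable_cexp _ u _ measurable_snd), h₀]
    simp_rw [← charFun_apply_real, hκc]
    rw [integral_const_mul, integral_prod_mul (fun k => charFun ρ₁ u ^ k)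
      (fun k => charFun ρ₂ u ^ k), integral_poissonMeasure_pow, integral_poissonMeasure_pow]
  have hP₁ : ∀ u : ℝ, charFun P₁ u =
      ∫ ω, (W ω : ℂ) * Complex.exp (u * ω.2 * Complex.I) ∂Q := by
    intro u
    have hi : Integrable (fun ω => (W ω : ℂ) * Complex.exp (u * ω.2 * Complex.I)) Q :=
      hWi.ofReal.mul_bdd (c := 1) (by fun_prop)
        (ae_of_all _ fun ω => (norm_cexp_real_mul_I _ _).le)
    rw [Measure.integral_compProd hi, h₁, h₀]
    simp only [W]
    simp_rw [integral_const_mul, ← charFun_apply_real, hκc, mul_left_comm _ (charFun R u)]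
    rw [integral_const_mul, integral_mehlerKernel_mul_pow hr hδ hδ'
      (norm_charFun_le_one u) (norm_charFun_le_one u)]
    ring
  have := exists_density_of_charFun (Q := Q) measurable_snd hWm hWb hP₁
  rwa [hP₀] at this

/-! ### Symmetric Lévy measures and the Orey class -/

namespace IsSymmJump

variable {ν J : Measure ℝ}

lemma sigmaFinite (h : IsSymmJump ν) : SigmaFinite ν := by
  refine ⟨⟨⟨fun n => {0} ∪ {x : ℝ | 1 / (n + 1 : ℝ) < |x|}, fun _ => trivial, fun n => ?_, ?_⟩⟩⟩
  · refine (measure_union_le _ _).trans_lt ?_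
    rw [h.zero, zero_add]
    exact h.measure_lt_abs_lt_top (by positivity)
  · rw [← union_iUnion, iUnion_cutoff, union_compl_self]

lemma isInfiniteLevyMeasure (h : IsSymmJump ν) (hinf : ν univ = ∞) : IsInfiniteLevyMeasure ν :=
  ⟨h.zero, hinf, (lintegral_mono fun _ => ENNReal.ofReal_le_ofReal (min_le_left _ _)).trans_lt
    h.lintegral_sq⟩

lemma mem_oreyClass (h : IsSymmJump ν) (hinf : ν univ = ∞) {ε M α : ℝ}
    (hM : ∀ η, 0 < η → η ≤ ε →
      ENNReal.ofReal (M * η ^ (2 - α)) ≤ ∫⁻ x in Icc (-η) η, ENNReal.ofReal (x ^ 2) ∂ν) :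
    ν ∈ OreyClass ε M α := by
  have := h.sigmaFinite
  have hd : ν = volume.withDensity (fun x => ENNReal.ofReal (ν.rnDeriv volume x).toReal) := by
    refine (Measure.withDensity_rnDeriv_eq _ _ h.absolutelyContinuous).symm.trans
      (withDensity_congr_ae ?_)
    filter_upwards [ν.rnDeriv_lt_top volume] with x hx
    exact (ENNReal.ofReal_toReal hx.ne).symm
  refine ⟨h.isInfiniteLevyMeasure hinf, fun x => (ν.rnDeriv volume x).toReal, by fun_prop,
    fun x => ENNReal.toReal_nonneg, hd, fun η hη hηε => ?_⟩
  have e : ∫ x in Icc (-η) η, x ^ 2 * (ν.rnDeriv volume x).toReal =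
      (∫⁻ x in Icc (-η) η, ENNReal.ofReal (x ^ 2) ∂ν).toReal := by
    rw [← integral_toReal (by fun_prop) (by simp)]
    conv_rhs => rw [hd]
    rw [setIntegral_withDensity_eq_setIntegral_toReal_smul (by fun_prop) (by simp)
      _ measurableSet_Icc]
    refine integral_congr_ae (ae_of_all _ fun x => ?_)
    simp only [smul_eq_mul]
    rw [ENNReal.toReal_ofReal ENNReal.toReal_nonneg, ENNReal.toReal_ofReal (sq_nonneg x), mul_comm]
  rw [e]
  have hfin : ∫⁻ x in Icc (-η) η, ENNReal.ofReal (x ^ 2) ∂ν ≠ ∞ :=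
    ((setLIntegral_le_lintegral _ _).trans_lt h.lintegral_sq).ne
  exact (ENNReal.ofReal_le_iff_le_toReal hfin).1 (hM η hη hηε)

lemma levyDrift_eq_zero (h : IsSymmJump ν) : levyDrift ν = 0 := by
  rw [levyDrift, h.integral_odd measurableSet_Icc, ite_self]
  intro x
  simp only [mem_Icc, ← abs_le, abs_neg]

lemma smallJumpDrift_eq_zero (h : IsSymmJump ν) (ε : ℝ) : smallJumpDrift ε ν = 0 := by
  rw [smallJumpDrift, h.integral_odd measurableSet_Icc, h.integral_odd, neg_zero, ite_self]
  · exact (measurableSet_lt_abs ε).inter (measurableSet_le measurable_abs measurable_const)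
  · intro x
    simp
  · intro x
    simp only [mem_Icc, ← abs_le, abs_neg]

lemma norm_cexp_sub_le (t : ℝ) :
    ‖Complex.exp (Complex.I * t) - 1 - Complex.I * t‖ ≤ 3 * t ^ 2 := by
  rcases le_total |t| 1 with ht | ht
  · have := Complex.norm_exp_sub_one_sub_id_le (x := Complex.I * t) (by simpa using ht)
    simp only [norm_mul, Complex.norm_I, one_mul, Complex.norm_real, Real.norm_eq_abs, sq_abs]
      at this
    nlinarith [sq_nonneg t]
  · have h1 : ‖Complex.exp (Complex.I * t)‖ = 1 := by
      rw [mul_comm]; exact Complex.norm_exp_ofReal_mul_I t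
    calc ‖Complex.exp (Complex.I * t) - 1 - Complex.I * t‖
        ≤ ‖Complex.exp (Complex.I * t)‖ + ‖(1 : ℂ)‖ + ‖Complex.I * t‖ :=
          (norm_sub_le _ _).trans (by gcongr; exact norm_sub_le _ _)
      _ = 2 + |t| := by rw [h1]; simp; norm_num
      _ ≤ 3 * t ^ 2 := by rw [← sq_abs]; nlinarith

lemma cexp_add_cexp_neg (u x : ℝ) :
    Complex.exp (Complex.I * u * x) + Complex.exp (Complex.I * u * (-x : ℝ)) =
      2 * (Real.cos (u * x) : ℂ) := by
  rw [Complex.ofReal_cos, Complex.two_cos]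
  push_cast
  ring_nf

/-- The compensator is odd, so its truncation plays no role, and the exponent agrees with the fully
compensated one. -/
lemma integral_levyKhintchine (h : IsSymmJump ν) (u : ℝ) :
    ∫ x, (Complex.exp (Complex.I * u * x) - 1 -
      {y : ℝ | |y| < 1}.indicator (fun y : ℝ => Complex.I * u * y) x) ∂ν =
      ((∫ x, (Real.cos (u * x) - 1) ∂ν : ℝ) : ℂ) := by
  have hs : MeasurableSet {y : ℝ | |y| < 1} := measurableSet_lt measurable_abs measurable_const
  refine h.integral_eq_ofReal ?_ fun x => ?_
  -- The term `3 u ^ 2` covers `|x| < 1`. Beyond, the integrand is at most `2 ≤ 2 x ^ 2`.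
  · refine (h.integrable_sq.const_mul (3 * u ^ 2 + 2)).mono' ?_ (ae_of_all _ fun x => ?_)
    · have : Measurable ({y : ℝ | |y| < 1}.indicator (fun y : ℝ => Complex.I * u * y)) :=
        Measurable.indicator (by fun_prop) hs
      fun_prop
    · by_cases hx : |x| < 1
      · rw [indicator_of_mem (show x ∈ {y : ℝ | |y| < 1} from hx)]
        have := norm_cexp_sub_le (u * x)
        push_cast at this
        rw [← mul_assoc] at this
        nlinarith [sq_nonneg x]
      · rw [indicator_of_notMem (show x ∉ {y : ℝ | |y| < 1} from hx), sub_zero]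
        have h1 : ‖Complex.exp (Complex.I * u * x)‖ = 1 := by
          rw [← norm_cexp_real_mul_I u x]
          ring_nf
        have h2 := norm_sub_le (Complex.exp (Complex.I * u * x)) 1
        rw [h1, norm_one] at h2
        have h3 : 1 ≤ x ^ 2 := by
          rw [← sq_abs]
          nlinarith
        nlinarith [mul_nonneg (sq_nonneg u) (sq_nonneg x)]
  · have hind : {y : ℝ | |y| < 1}.indicator (fun y : ℝ => Complex.I * u * y) (-x) =
        -{y : ℝ | |y| < 1}.indicator (fun y : ℝ => Complex.I * u * y) x := by
      by_cases hx : |x| < 1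
      · rw [indicator_of_mem (show x ∈ {y : ℝ | |y| < 1} from hx),
          indicator_of_mem (show -x ∈ {y : ℝ | |y| < 1} by simpa using hx)]
        push_cast
        ring
      · rw [indicator_of_notMem (show x ∉ {y : ℝ | |y| < 1} from hx),
          indicator_of_notMem (show -x ∉ {y : ℝ | |y| < 1} by simpa using hx), neg_zero]
    rw [hind]
    have := cexp_add_cexp_neg u x
    push_cast at this ⊢
    linear_combination this

lemma integral_compensated (h : IsSymmJump ν) (u : ℝ) :
    ∫ x : ℝ, (Complex.exp (Complex.I * u * x) - 1 - Complex.I * u * x) ∂ν =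
      ((∫ x, (Real.cos (u * x) - 1) ∂ν : ℝ) : ℂ) := by
  refine h.integral_eq_ofReal ?_ fun x => ?_
  · refine (h.integrable_sq.const_mul (3 * u ^ 2)).mono' (by fun_prop) (ae_of_all _ fun x => ?_)
    have := norm_cexp_sub_le (u * x)
    push_cast at this
    rw [← mul_assoc] at this
    linarith
  · have := cexp_add_cexp_neg u x
    push_cast at this ⊢
    linear_combination this

lemma isIncrementLaw (h : IsSymmJump ν) {Δ : ℝ} {P : Measure ℝ} [hP : IsProbabilityMeasure P]
    (hc : ∀ u : ℝ, charFun P u =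
      Complex.exp ((Δ * ∫ x, (Real.cos (u * x) - 1) ∂ν : ℝ) : ℂ)) : IsIncrementLaw ν Δ P := by
  refine ⟨hP, fun u => ?_⟩
  rw [hc, h.integral_levyKhintchine, h.levyDrift_eq_zero]
  push_cast
  ring_nf

/-- Without jumps above `ε` and without drift, `Z_Δ` is `X_Δ`, so the law of the increment is the
one to be estimated. -/
lemma isSmallJumpDensity (h : IsSymmJump ν) {ε Δ : ℝ} (hsupp : ν (Icc (-ε) ε)ᶜ = 0)
    {P : Measure ℝ} [hP : IsProbabilityMeasure P]
    (hc : ∀ u : ℝ, charFun P u =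
      Complex.exp ((Δ * ∫ x, (Real.cos (u * x) - 1) ∂ν : ℝ) : ℂ)) {g : ℝ → ℝ} (hg : Measurable g)
    (hg0 : ∀ x, 0 ≤ g x) (hgP : volume.withDensity (fun x => ENNReal.ofReal (g x)) = P) :
    IsSmallJumpDensity ε ν Δ g := by
  refine ⟨hg, hg0, by rwa [hgP], fun u => ?_⟩
  have hr : ν.restrict (Icc (-ε) ε) = ν :=
    Measure.restrict_eq_self_of_ae_mem (by rwa [ae_iff])
  rw [hgP, hc, hr, h.integral_compensated, h.smallJumpDrift_eq_zero]
  push_cast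
  ring_nf

end IsSymmJump

lemma exists_real_density {P : Measure ℝ} [IsProbabilityMeasure P] (hP : P ≪ volume) :
    ∃ g : ℝ → ℝ, Measurable g ∧ (∀ x, 0 ≤ g x) ∧
      volume.withDensity (fun x => ENNReal.ofReal (g x)) = P := by
  refine ⟨fun x => (P.rnDeriv volume x).toReal, by fun_prop, fun x => ENNReal.toReal_nonneg, ?_⟩
  refine Eq.trans (withDensity_congr_ae ?_) (Measure.withDensity_rnDeriv_eq _ _ hP)
  filter_upwards [P.rnDeriv_lt_top volume] with x hx
  exact ENNReal.ofReal_toReal hx.ne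

/-! ### Symmetrised Lévy measures -/

/-- The symmetrisation `μ + μ(-·)` of a measure. -/
def symmetrize (μ : Measure ℝ) : Measure ℝ := μ + μ.map (fun x => -x)

section Symmetrize

variable {μ ν : Measure ℝ}

lemma map_neg_absolutelyContinuous (hμ : μ ≪ volume) : μ.map (fun x => -x) ≪ volume := by
  have h := hμ.map (f := fun x : ℝ => -x) measurable_neg
  have e : (volume : Measure ℝ).map (fun x => -x) = volume := Measure.map_neg_eq_self volume
  rwa [e] at h

lemma isSymmJump_symmetrize (hμ : μ ≪ volume) (hsq : ∫⁻ x, ENNReal.ofReal (x ^ 2) ∂μ < ∞) :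
    IsSymmJump (symmetrize μ) := by
  refine ⟨?_, hμ.add_left (map_neg_absolutelyContinuous hμ), ?_⟩
  · rw [symmetrize, Measure.map_add _ _ measurable_neg,
      Measure.map_map measurable_neg measurable_neg, add_comm]
    simp
  · rw [symmetrize, lintegral_add_measure, lintegral_map (by fun_prop) measurable_neg]
    simp only [neg_sq]
    exact ENNReal.add_lt_top.2 ⟨hsq, hsq⟩

lemma le_symmetrize (μ : Measure ℝ) : μ ≤ symmetrize μ := Measure.le_add_right le_rfl

lemma integral_symmetrize (u : ℝ) (hμ : IsSymmJump (symmetrize μ)) :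
    ∫ x, (Real.cos (u * x) - 1) ∂(symmetrize μ) = 2 * ∫ x, (Real.cos (u * x) - 1) ∂μ := by
  have hi := hμ.integrable_cos_sub_one u
  rw [symmetrize] at hi ⊢
  rw [integral_add_measure (hi.mono_measure (Measure.le_add_right le_rfl))
    (hi.mono_measure (Measure.le_add_left le_rfl)),
    integral_map (by fun_prop) (by fun_prop)]
  simp only [mul_neg, Real.cos_neg]
  ring

lemma symmetrize_compl_Icc {ε : ℝ} (h : μ (Icc (-ε) ε)ᶜ = 0) :
    symmetrize μ (Icc (-ε) ε)ᶜ = 0 := by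
  rw [symmetrize, Measure.add_apply, h, zero_add,
    Measure.map_apply measurable_neg measurableSet_Icc.compl]
  convert h using 2
  ext x
  simp only [preimage_compl, mem_compl_iff, mem_preimage, mem_Icc]
  rw [neg_le_neg_iff, neg_le, and_comm]

lemma setLIntegral_sq_symmetrize (μ : Measure ℝ) (η : ℝ) :
    ∫⁻ x in Icc (-η) η, ENNReal.ofReal (x ^ 2) ∂(symmetrize μ) =
      2 * ∫⁻ x in Icc (-η) η, ENNReal.ofReal (x ^ 2) ∂μ := by
  have hp : (fun x : ℝ => -x) ⁻¹' (Icc (-η) η) = Icc (-η) η := by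
    ext x
    simp only [mem_preimage, mem_Icc]
    rw [neg_le_neg_iff, neg_le, and_comm]
  rw [symmetrize, Measure.restrict_add, lintegral_add_measure,
    Measure.restrict_map measurable_neg measurableSet_Icc,
    lintegral_map (by fun_prop) measurable_neg, hp]
  simp only [neg_sq]
  rw [two_mul]

end Symmetrize

lemma lintegral_sq_lt_top_of_compl_Icc {μ : Measure ℝ} [IsFiniteMeasure μ] {ε : ℝ}
    (h : μ (Icc (-ε) ε)ᶜ = 0) : ∫⁻ x, ENNReal.ofReal (x ^ 2) ∂μ < ∞ := by
  have hb : ∀ᵐ x ∂μ, ENNReal.ofReal (x ^ 2) ≤ ENNReal.ofReal (ε ^ 2) := by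
    have : ∀ᵐ x ∂μ, x ∈ Icc (-ε) ε := by rwa [ae_iff]
    filter_upwards [this] with x hx
    refine ENNReal.ofReal_le_ofReal ?_
    exact sq_le_sq' hx.1 hx.2
  refine (lintegral_mono_ae hb).trans_lt ?_
  rw [lintegral_const]
  exact ENNReal.mul_lt_top ENNReal.ofReal_lt_top (measure_lt_top _ _)

/-! ### The one-sided truncated stable measure -/

/-- The measure `D x^{-1-α} dx` on `(0, ε]`. -/
def stableJump (D α ε : ℝ) : Measure ℝ :=
  (volume.restrict (Ioc 0 ε)).withDensity fun x => ENNReal.ofReal (D * x ^ (-1 - α))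

section Stable

variable {D α ε : ℝ}

lemma stableJump_absolutelyContinuous : stableJump D α ε ≪ volume :=
  (withDensity_absolutelyContinuous _ _).trans Measure.absolutelyContinuous_restrict

lemma stableJump_compl : stableJump D α ε (Ioc 0 ε)ᶜ = 0 := by
  refine withDensity_absolutelyContinuous _ _ ?_
  rw [Measure.restrict_apply measurableSet_Ioc.compl, compl_inter_self, measure_empty]

lemma setLIntegral_sq_stableJump (hD : 0 < D) (hα : α < 2) {η : ℝ} (hη : 0 < η) (hηε : η ≤ ε) :
    ∫⁻ x in Icc (-η) η, ENNReal.ofReal (x ^ 2) ∂(stableJump D α ε) =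
      ENNReal.ofReal (D * η ^ (2 - α) / (2 - α)) := by
  have hset : Icc (-η) η ∩ Ioc 0 ε = Ioc 0 η := by
    ext x
    simp only [mem_inter_iff, mem_Icc, mem_Ioc]
    constructor
    · rintro ⟨⟨_, h1⟩, h2, _⟩
      exact ⟨h2, h1⟩
    · rintro ⟨h1, h2⟩
      exact ⟨⟨by linarith, h2⟩, h1, h2.trans hηε⟩
  have hint : IntegrableOn (fun x : ℝ => D * x ^ (1 - α)) (Ioc 0 η) := by
    have := (intervalIntegral.intervalIntegrable_rpow' (a := 0) (b := η) (r := 1 - α)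
      (by linarith)).const_mul D
    rwa [intervalIntegrable_iff_integrableOn_Ioc_of_le hη.le] at this
  rw [stableJump, restrict_withDensity measurableSet_Icc,
    Measure.restrict_restrict measurableSet_Icc, hset,
    lintegral_withDensity_eq_lintegral_mul _ (by fun_prop) (by fun_prop)]
  have e1 : ∫⁻ x in Ioc 0 η, ((fun x => ENNReal.ofReal (D * x ^ (-1 - α))) *
      fun x => ENNReal.ofReal (x ^ 2)) x = ∫⁻ x in Ioc 0 η, ENNReal.ofReal (D * x ^ (1 - α)) := by
    refine setLIntegral_congr_fun measurableSet_Ioc fun x hx => ?_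
    have hx0 : 0 < x := hx.1
    simp only [Pi.mul_apply]
    rw [← ENNReal.ofReal_mul (by positivity), mul_assoc, ← Real.rpow_natCast x 2,
      ← Real.rpow_add hx0]
    congr 3
    push_cast
    ring
  rw [e1, ← ofReal_integral_eq_lintegral_ofReal hint, integral_const_mul,
    ← intervalIntegral.integral_of_le hη.le, integral_rpow (Or.inl (by linarith)),
    Real.zero_rpow (by linarith)]
  · congr 1
    rw [show 1 - α + 1 = 2 - α by ring]
    ring
  · filter_upwards [ae_restrict_mem measurableSet_Ioc] with x hx
    have hx0 : 0 < x := hx.1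
    show 0 ≤ D * x ^ (1 - α)
    positivity

lemma lintegral_sq_stableJump_lt_top (hD : 0 < D) (hα : α < 2) (hε : 0 < ε) :
    ∫⁻ x, ENNReal.ofReal (x ^ 2) ∂(stableJump D α ε) < ∞ := by
  have hr : (stableJump D α ε).restrict (Icc (-ε) ε) = stableJump D α ε := by
    refine Measure.restrict_eq_self_of_ae_mem ?_
    have : ∀ᵐ x ∂(stableJump D α ε), x ∈ Ioc 0 ε := by
      rw [ae_iff]; exact stableJump_compl
    filter_upwards [this] with x hx
    exact ⟨by linarith [hx.1], hx.2⟩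
  rw [← hr, setLIntegral_sq_stableJump hD hα hε le_rfl]
  exact ENNReal.ofReal_lt_top

lemma stableJump_univ (hD : 0 < D) (hα : 0 < α) (hε : 0 < ε) : stableJump D α ε univ = ∞ := by
  rw [stableJump, withDensity_apply _ MeasurableSet.univ, Measure.restrict_univ]
  by_contra h
  have hi : IntegrableOn (fun x : ℝ => D * x ^ (-1 - α)) (Ioc 0 ε) := by
    refine ⟨by fun_prop, ?_⟩
    rw [hasFiniteIntegral_iff_ofReal]
    · exact lt_top_iff_ne_top.2 h
    · filter_upwards [ae_restrict_mem measurableSet_Ioc] with x hx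
      have hx0 : 0 < x := hx.1
      show 0 ≤ D * x ^ (-1 - α)
      positivity
  have h2 : IntegrableOn (fun x : ℝ => x ^ (-1 - α)) (Ioo 0 ε) := by
    have := (hi.mono_set Ioo_subset_Ioc_self).const_mul D⁻¹
    refine this.congr (ae_of_all _ fun x => ?_)
    simp only
    rw [← mul_assoc, inv_mul_cancel₀ hD.ne', one_mul]
  rw [intervalIntegral.integrableOn_Ioo_rpow_iff hε] at h2
  linarith

lemma stableJump_Ioi_le (hD : 0 < D) (hα : 0 < α) {h : ℝ} (hh : 0 < h) :
    stableJump D α ε (Ioi h) ≤ ENNReal.ofReal (D * (h ^ (-α) / α)) := by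
  rw [stableJump, withDensity_apply _ measurableSet_Ioi,
    Measure.restrict_restrict measurableSet_Ioi]
  have hint : IntegrableOn (fun x : ℝ => D * x ^ (-1 - α)) (Ioi h) :=
    (integrableOn_Ioi_rpow_of_lt (by linarith) hh).const_mul D
  refine (lintegral_mono_set inter_subset_left).trans ?_
  rw [← ofReal_integral_eq_lintegral_ofReal hint, integral_const_mul,
    integral_Ioi_rpow_of_lt (by linarith) hh]
  · refine ENNReal.ofReal_le_ofReal (le_of_eq ?_)
    rw [show -1 - α + 1 = -α by ring, neg_div_neg_eq]
  · filter_upwards [ae_restrict_mem measurableSet_Ioi] with x hx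
    have hx0 : 0 < x := hh.trans hx
    show 0 ≤ D * x ^ (-1 - α)
    positivity

/-- The bound `1 - cos t ≤ t ^ 2 / 2` is used for jumps up to `h`, and `1 - cos t ≤ 2` above. -/
lemma integral_one_sub_cos_stableJump_le (hD : 0 < D) (hα : α < 2) {h : ℝ}
    (hh : 0 < h) (hhε : h ≤ ε) {B : ℝ} (hB : 0 ≤ B)
    (htail : stableJump D α ε (Ioi h) ≤ ENNReal.ofReal B) (u : ℝ) :
    ∫ x, (1 - Real.cos (u * x)) ∂(stableJump D α ε) ≤
      u ^ 2 / 2 * (D * h ^ (2 - α) / (2 - α)) + 2 * B := by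
  have hC : 0 ≤ D * h ^ (2 - α) / (2 - α) :=
    div_nonneg (by positivity) (by linarith)
  rw [integral_eq_lintegral_of_nonneg_ae (ae_of_all _ fun x => by
    simpa using Real.cos_le_one (u * x)) (by fun_prop)]
  refine ENNReal.toReal_le_of_le_ofReal (by positivity) ?_
  rw [← lintegral_add_compl _ (measurableSet_Icc (a := -h) (b := h)),
    ENNReal.ofReal_add (by positivity) (by positivity)]
  gcongr
  · rw [ENNReal.ofReal_mul (by positivity), ← setLIntegral_sq_stableJump hD hα hh hhε,
      ← lintegral_const_mul _ (by fun_prop)]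
    refine lintegral_mono fun x => ?_
    rw [← ENNReal.ofReal_mul (by positivity)]
    refine ENNReal.ofReal_le_ofReal ?_
    have := Real.one_sub_sq_div_two_le_cos (x := u * x)
    rw [mul_pow] at this
    linarith
  · rw [ENNReal.ofReal_mul (by positivity)]
    refine (lintegral_mono (g := fun _ => ENNReal.ofReal 2) fun x =>
      ENNReal.ofReal_le_ofReal (by linarith [Real.neg_one_le_cos (u * x)])).trans ?_
    rw [lintegral_const, Measure.restrict_apply_univ]
    gcongr
    refine le_trans ?_ htail
    have hsub : (Icc (-h) h)ᶜ ⊆ Ioi h ∪ (Ioc 0 ε)ᶜ := by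
      intro x hx
      by_cases h1 : h < x
      · exact Or.inl h1
      · refine Or.inr fun h2 => hx ⟨by linarith [h2.1], not_lt.1 h1⟩
    refine (measure_mono hsub).trans ((measure_union_le _ _).trans ?_)
    rw [stableJump_compl, add_zero]

end Stable

/-! ### Characteristic functions of jump laws -/

lemma integral_cos_sub_one (μ : Measure ℝ) [IsProbabilityMeasure μ] (u : ℝ) :
    ∫ x, (Real.cos (u * x) - 1) ∂μ = (charFun μ u).re - 1 := by
  have hi : Integrable (fun x : ℝ => Complex.exp (u * x * Complex.I)) μ :=
    integrable_cexp μ u (fun x => x) measurable_id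
  have h1 : ∫ x : ℝ, (Complex.exp (u * x * Complex.I)).re ∂μ = (charFun μ u).re := by
    rw [charFun_apply_real]
    exact Complex.reCLM.integral_comp_comm hi
  have h2 : ∀ x : ℝ, (Complex.exp (u * x * Complex.I)).re = Real.cos (u * x) := by
    intro x
    have := Complex.exp_ofReal_mul_I_re (u * x)
    push_cast at this
    exact this
  simp_rw [h2] at h1
  have hc : Integrable (fun x : ℝ => Real.cos (u * x)) μ := by
    refine hi.re.congr (ae_of_all _ fun x => ?_)
    exact h2 x
  rw [integral_sub hc (integrable_const _), h1]
  simp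

lemma charFun_map_neg (μ : Measure ℝ) (u : ℝ) :
    charFun (μ.map fun x => -x) u = (starRingEnd ℂ) (charFun μ u) := by
  have := charFun_map_mul (μ := μ) (-1) u
  simp only [neg_one_mul] at this
  rw [this, charFun_neg]

/-- The uniform law on `[h / 2, h]`. -/
def uniformJump (h : ℝ) : Measure ℝ := volume[|Icc (h / 2) h]

section Uniform

variable {h : ℝ}

lemma isProbabilityMeasure_uniformJump (hh : 0 < h) : IsProbabilityMeasure (uniformJump h) := by
  refine cond_isProbabilityMeasure_of_finite ?_ ?_
  · rw [Real.volume_Icc]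
    simp
    linarith
  · simp

lemma uniformJump_absolutelyContinuous : uniformJump h ≪ volume := cond_absolutelyContinuous

lemma ae_mem_uniformJump : ∀ᵐ x ∂(uniformJump h), x ∈ Icc (h / 2) h :=
  ae_cond_mem measurableSet_Icc

lemma uniformJump_compl_Icc (hh : 0 < h) {ε : ℝ} (hε : h ≤ ε) :
    uniformJump h (Icc (-ε) ε)ᶜ = 0 := by
  have : ∀ᵐ x ∂(uniformJump h), x ∈ Icc (-ε) ε := by
    filter_upwards [ae_mem_uniformJump] with x hx
    exact ⟨by linarith [hx.1], hx.2.trans hε⟩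
  rwa [ae_iff] at this

lemma integral_one_sub_cos_uniformJump_le (hh : 0 < h) (u : ℝ) :
    1 - (charFun (uniformJump h) u).re ≤ u ^ 2 * h ^ 2 / 2 := by
  have := isProbabilityMeasure_uniformJump hh
  have h1 := integral_cos_sub_one (uniformJump h) u
  have h2 : -(u ^ 2 * h ^ 2 / 2) ≤ ∫ x, (Real.cos (u * x) - 1) ∂(uniformJump h) := by
    have hc : ∫ _, -(u ^ 2 * h ^ 2 / 2) ∂(uniformJump h) = -(u ^ 2 * h ^ 2 / 2) := by simp
    rw [← hc]
    refine integral_mono_ae (integrable_const _) ?_ ?_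
    · refine Integrable.of_bound (C := 2) (by fun_prop) (ae_of_all _ fun x => ?_)
      rw [Real.norm_eq_abs, abs_le]
      constructor <;> linarith [Real.cos_le_one (u * x), Real.neg_one_le_cos (u * x)]
    · filter_upwards [ae_mem_uniformJump] with x hx
      have h3 := Real.one_sub_sq_div_two_le_cos (x := u * x)
      have h4 : x ^ 2 ≤ h ^ 2 := by
        have := hx.1
        have := hx.2
        gcongr
        linarith
      rw [mul_pow] at h3
      nlinarith [sq_nonneg u]
  linarith

/-- Jordan's inequality `sin t ≥ 2 t / π` with `t = u x ≥ u h / 2`. Jumps of one sign make this of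
first order in `u h`, as the separation requires. -/
lemma le_charFun_uniformJump_im (hh : 0 < h) {u : ℝ} (hu : 0 ≤ u) (hu' : u * h ≤ 1) :
    u * h / Real.pi ≤ (charFun (uniformJump h) u).im := by
  have := isProbabilityMeasure_uniformJump hh
  have hi : Integrable (fun x : ℝ => Complex.exp (u * x * Complex.I)) (uniformJump h) :=
    integrable_cexp _ u (fun x => x) measurable_id
  have h1 : ∫ x : ℝ, (Complex.exp (u * x * Complex.I)).im ∂(uniformJump h) =
      (charFun (uniformJump h) u).im := by
    rw [charFun_apply_real]
    exact Complex.imCLM.integral_comp_comm hi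
  have h2 : ∀ x : ℝ, (Complex.exp (u * x * Complex.I)).im = Real.sin (u * x) := by
    intro x
    have := Complex.exp_ofReal_mul_I_im (u * x)
    push_cast at this
    exact this
  simp_rw [h2] at h1
  have hc : ∫ _, u * h / Real.pi ∂(uniformJump h) = u * h / Real.pi := by simp
  rw [← h1, ← hc]
  refine integral_mono_ae (integrable_const _) ?_ ?_
  · refine Integrable.of_bound (C := 1) (by fun_prop) (ae_of_all _ fun x => ?_)
    exact Real.abs_sin_le_one _
  · filter_upwards [ae_mem_uniformJump] with x hx
    have hx1 := hx.1
    have hx2 := hx.2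
    have hux : u * x ≤ u * h := by gcongr
    have h3 := Real.mul_le_sin (x := u * x) (by
      have : 0 ≤ x := by linarith
      positivity) (by linarith [Real.pi_gt_three])
    refine le_trans ?_ h3
    have hpi := Real.pi_pos
    rw [div_mul_eq_mul_div, div_le_div_iff_of_pos_right hpi]
    nlinarith

end Uniform

/-- The law of the difference of two independent variables of law `μ`. -/
def selfDifference (μ : Measure ℝ) : Measure ℝ := μ ∗ μ.map fun x => -x

section SelfDifference

variable {μ : Measure ℝ}

instance isProbabilityMeasure_map_neg [IsProbabilityMeasure μ] : IsProbabilityMeasure (μ.map fun x : ℝ => -x) :=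
  Measure.isProbabilityMeasure_map (by fun_prop)

instance isProbabilityMeasure_selfDifference [IsProbabilityMeasure μ] :
    IsProbabilityMeasure (selfDifference μ) := by
  rw [selfDifference]
  infer_instance

lemma charFun_selfDifference [IsProbabilityMeasure μ] (u : ℝ) :
    charFun (selfDifference μ) u = ((Complex.normSq (charFun μ u) : ℝ) : ℂ) := by
  rw [selfDifference, charFun_conv, charFun_map_neg, Complex.mul_conj]

lemma selfDifference_compl_Icc [SFinite μ] {h : ℝ} (hμ : ∀ᵐ x ∂μ, x ∈ Icc 0 h) :
    selfDifference μ (Icc (-h) h)ᶜ = 0 := by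
  have h2 : ∀ᵐ x ∂(μ.map fun x => -x), x ∈ Icc (-h) 0 := by
    refine (ae_map_iff (p := fun x => x ∈ Icc (-h) 0) (by fun_prop) measurableSet_Icc).2 ?_
    filter_upwards [hμ] with x hx
    exact ⟨neg_le_neg hx.2, neg_nonpos.2 hx.1⟩
  have h3 : ∀ᵐ z ∂(selfDifference μ), z ∈ Icc (-h) h := by
    rw [selfDifference, Measure.conv]
    refine (ae_map_iff (p := fun x => x ∈ Icc (-h) h) (by fun_prop) measurableSet_Icc).2 ?_
    have e1 := Measure.quasiMeasurePreserving_fst (μ := μ) (ν := μ.map fun x => -x) |>.ae hμ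
    have e2 := Measure.quasiMeasurePreserving_snd (μ := μ) (ν := μ.map fun x => -x) |>.ae h2
    filter_upwards [e1, e2] with p h1 h2
    exact ⟨by linarith [h1.1, h2.1], by linarith [h1.2, h2.2]⟩
  rwa [ae_iff] at h3

lemma isSymmJump_selfDifference [IsProbabilityMeasure μ] {h : ℝ} (hμ : ∀ᵐ x ∂μ, x ∈ Icc 0 h) (hac : μ ≪ volume) :
    IsSymmJump (selfDifference μ) := by
  refine ⟨?_, Measure.conv_absolutelyContinuous (map_neg_absolutelyContinuous hac),
    lintegral_sq_lt_top_of_compl_Icc (selfDifference_compl_Icc hμ)⟩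
  refine Measure.ext_of_charFun (funext fun u => ?_)
  rw [charFun_map_neg, charFun_selfDifference, Complex.conj_ofReal]

end SelfDifference

/-! ### Reduction of the minimax risk to two hypotheses -/

lemma lintegral_sub_sq_le (t g₀ g₁ : ℝ → ℝ) (ht : Measurable t) (hg₀ : Measurable g₀) :
    ∫⁻ y, ENNReal.ofReal ((g₀ y - g₁ y) ^ 2) ≤
      2 * ((∫⁻ y, ENNReal.ofReal ((t y - g₀ y) ^ 2)) +
        ∫⁻ y, ENNReal.ofReal ((t y - g₁ y) ^ 2)) := by
  rw [← lintegral_add_left (by fun_prop), ← lintegral_const_mul' _ _ (by simp)]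
  refine lintegral_mono fun y => ?_
  have h2 : (2 : ℝ≥0∞) = ENNReal.ofReal 2 := by simp
  rw [← ENNReal.ofReal_add (sq_nonneg _) (sq_nonneg _), h2, ← ENNReal.ofReal_mul zero_le_two]
  refine ENNReal.ofReal_le_ofReal ?_
  nlinarith [sq_nonneg (t y - g₀ y + (t y - g₁ y))]

/-- Equal large-jump measures make the estimator the same function of the data under both
hypotheses. The factor `8` is made of `2` from the parallelogram inequality, `2` from Le Cam's
bound, and `2` from replacing the sum of two risks by twice their supremum. -/
lemma le_minimaxRisk_of_two_points {n : ℕ} {Δ ε M α : ℝ} {ν₀ ν₁ P₀ P₁ : Measure ℝ} {g₀ g₁ : ℝ → ℝ}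
    (hν₀ : ν₀ ∈ OreyClass ε M α) (hν₁ : ν₁ ∈ OreyClass ε M α)
    (hlarge : largeJumpMeasure ε ν₀ = largeJumpMeasure ε ν₁)
    (hP₀ : IsIncrementLaw ν₀ Δ P₀) (hP₁ : IsIncrementLaw ν₁ Δ P₁)
    (hg₀ : IsSmallJumpDensity ε ν₀ Δ g₀) (hg₁ : IsSmallJumpDensity ε ν₁ Δ g₁)
    {h : ℝ → ℝ} (hm : Measurable h) (h0 : ∀ x, 0 ≤ h x) {χ : ℝ} (hχ0 : 0 ≤ χ)
    (hP : P₁ = P₀.withDensity fun x => ENNReal.ofReal (h x))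
    (hχ : ∫⁻ x, ENNReal.ofReal ((h x - 1) ^ 2) ∂P₀ ≤ ENNReal.ofReal χ)
    (hn : (1 + χ) ^ n ≤ 5 / 4) :
    (∫⁻ y, ENNReal.ofReal ((g₀ y - g₁ y) ^ 2)) / 8 ≤ minimaxRisk n Δ ε M α := by
  refine le_iInf₂ fun T hT => ?_
  set S := ⨆ (ν : Measure ℝ) (_ : ν ∈ OreyClass ε M α)
      (P : Measure ℝ) (_ : IsIncrementLaw ν Δ P)
      (g : ℝ → ℝ) (_ : IsSmallJumpDensity ε ν Δ g),
      integratedRisk n P (T (largeJumpMeasure ε ν)) g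
  have h₀ : integratedRisk n P₀ (T (largeJumpMeasure ε ν₀)) g₀ ≤ S :=
    le_iSup₂_of_le ν₀ hν₀ (le_iSup₂_of_le P₀ hP₀ (le_iSup₂_of_le g₀ hg₀ le_rfl))
  have h₁ : integratedRisk n P₁ (T (largeJumpMeasure ε ν₀)) g₁ ≤ S := by
    rw [hlarge]
    exact le_iSup₂_of_le ν₁ hν₁ (le_iSup₂_of_le P₁ hP₁ (le_iSup₂_of_le g₁ hg₁ le_rfl))
  have := hP₀.isProbabilityMeasure
  have hprob : IsProbabilityMeasure (P₀.withDensity fun x => ENNReal.ofReal (h x)) := by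
    rw [← hP]
    exact hP₁.isProbabilityMeasure
  have hTm := hT (largeJumpMeasure ε ν₀)
  have hTx : ∀ x, Measurable (T (largeJumpMeasure ε ν₀) x) := fun x =>
    hTm.comp measurable_prodMk_left
  have hmeas : ∀ g : ℝ → ℝ, Measurable g → Measurable fun x : Fin n → ℝ =>
      ∫⁻ y : ℝ, ENNReal.ofReal ((T (largeJumpMeasure ε ν₀) x y - g y) ^ 2) := by
    intro g hg
    refine Measurable.lintegral_prod_right' (f := fun p : (Fin n → ℝ) × ℝ =>
      ENNReal.ofReal ((T (largeJumpMeasure ε ν₀) p.1 p.2 - g p.2) ^ 2)) ?_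
    exact ((hTm.sub (hg.comp measurable_snd)).pow_const 2).ennreal_ofReal
  have key := half_le_lintegral_pi_add (n := n) P₀ hm h0 hχ0 hprob hχ hn
    (hmeas g₀ hg₀.measurable) (hmeas g₁ hg₁.measurable)
    (d := (∫⁻ y, ENNReal.ofReal ((g₀ y - g₁ y) ^ 2)) / 2) fun x =>
      ENNReal.div_le_of_le_mul' (lintegral_sub_sq_le _ _ _ (hTx x) hg₀.measurable)
  rw [← hP] at key
  change _ ≤ integratedRisk n P₀ (T (largeJumpMeasure ε ν₀)) g₀ +
    integratedRisk n P₁ (T (largeJumpMeasure ε ν₀)) g₁ at key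
  have h2 : (∫⁻ y, ENNReal.ofReal ((g₀ y - g₁ y) ^ 2)) / 2 / 2 ≤ 2 * S :=
    key.trans ((add_le_add h₀ h₁).trans_eq (two_mul S).symm)
  have h3 := ENNReal.div_le_of_le_mul' h2
  refine le_trans (le_of_eq ?_) h3
  rw [div_eq_mul_inv, div_eq_mul_inv, div_eq_mul_inv, div_eq_mul_inv, mul_assoc, mul_assoc]
  congr 1
  rw [← ENNReal.mul_inv (by simp) (by simp), ← ENNReal.mul_inv (by simp) (by simp)]
  norm_num

/-! ### Separation of the densities -/

/-- Fubini, with the Gaussian characteristic function. It replaces Plancherel's identity, with no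
integrability of `charFun P` to check. -/
lemma integral_charFun_gaussianReal (P : Measure ℝ) [IsProbabilityMeasure P] (v : ℝ≥0) :
    ∫ u, charFun P u ∂(gaussianReal 0 v) = ((∫ x, Real.exp (-(v * x ^ 2 / 2)) ∂P : ℝ) : ℂ) := by
  simp_rw [charFun_apply_real]
  rw [integral_integral_swap]
  · rw [← integral_complex_ofReal]
    refine integral_congr_ae (ae_of_all _ fun x => ?_)
    have h1 := charFun_gaussianReal (μ := 0) (v := v) x
    rw [charFun_apply_real] at h1
    simp only
    simp_rw [mul_comm _ (x : ℂ)]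
    rw [h1]
    push_cast
    ring_nf
  · refine Integrable.of_bound (C := 1) (by fun_prop) (ae_of_all _ fun p => ?_)
    exact (norm_cexp_real_mul_I _ _).le

/-- A lower bound for the standard Gaussian mass of `[1/2, 1]`. -/
def gaussianMassBound : ℝ := (√(2 * Real.pi))⁻¹ * Real.exp (-(1 / 2)) / 2

lemma gaussianMassBound_pos : 0 < gaussianMassBound := by
  unfold gaussianMassBound
  positivity

lemma gaussianMassBound_le {w : ℝ} (hw : 0 < w) :
    gaussianMassBound ≤
      (gaussianReal 0 (Real.toNNReal ((w ^ 2)⁻¹))).real (Icc (1 / (2 * w)) (1 / w)) := by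
  have hv : Real.toNNReal ((w ^ 2)⁻¹) ≠ 0 := by
    rw [ne_eq, Real.toNNReal_eq_zero, not_le]
    positivity
  have hvc : ((Real.toNNReal ((w ^ 2)⁻¹) : ℝ≥0) : ℝ) = (w ^ 2)⁻¹ :=
    Real.coe_toNNReal _ (by positivity)
  rw [measureReal_def, gaussianReal_apply_eq_integral _ hv, ENNReal.toReal_ofReal
    (integral_nonneg fun x => gaussianPDFReal_nonneg _ _ _)]
  have hlow : ∀ x ∈ Icc (1 / (2 * w)) (1 / w),
      w * (√(2 * Real.pi))⁻¹ * Real.exp (-(1 / 2)) ≤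
        gaussianPDFReal 0 (Real.toNNReal ((w ^ 2)⁻¹)) x := by
    intro x hx
    have hx0 : 0 < x := lt_of_lt_of_le (by positivity) hx.1
    have hxw : x * w ≤ 1 := by
      have := hx.2
      rwa [le_div_iff₀ hw] at this
    rw [gaussianPDFReal, hvc, Real.sqrt_mul (x := 2 * Real.pi) (by positivity), Real.sqrt_inv,
      Real.sqrt_sq hw.le, mul_inv, inv_inv, mul_comm w]
    gcongr
    rw [sub_zero]
    have e : -x ^ 2 / (2 * (w ^ 2)⁻¹) = -((x * w) ^ 2 / 2) := by
      field_simp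
    rw [e]
    have : (x * w) ^ 2 ≤ 1 := pow_le_one₀ (by positivity) hxw
    linarith
  have hint : IntegrableOn (gaussianPDFReal 0 (Real.toNNReal ((w ^ 2)⁻¹)))
      (Icc (1 / (2 * w)) (1 / w)) := (integrable_gaussianPDFReal _ _).integrableOn
  have hc := setIntegral_mono_on (integrableOn_const (μ := volume)
    (C := w * (√(2 * Real.pi))⁻¹ * Real.exp (-(1 / 2))) (by simp)) hint measurableSet_Icc hlow
  refine le_trans (le_of_eq ?_) hc
  rw [setIntegral_const, Real.volume_real_Icc_of_le, gaussianMassBound, smul_eq_mul]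
  · field_simp
    ring
  · gcongr
    linarith

lemma integral_sq_gaussian {w : ℝ} (hw : 0 < w) :
    ∫ x, Real.exp (-((w ^ 2)⁻¹ * x ^ 2 / 2)) ^ 2 = w * √Real.pi := by
  have e : ∀ x : ℝ, Real.exp (-((w ^ 2)⁻¹ * x ^ 2 / 2)) ^ 2 = Real.exp (-(w ^ 2)⁻¹ * x ^ 2) := by
    intro x
    rw [← Real.exp_nat_mul]
    congr 1
    push_cast
    ring
  simp_rw [e]
  rw [integral_gaussian, div_inv_eq_mul, Real.sqrt_mul (by positivity), Real.sqrt_sq hw.le,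
    mul_comm]

/-- Testing `g₁ - g₀` against a Gaussian of width `w` amounts to integrating `f₁ - f₀` against a
Gaussian law of width `1 / w`. As `f₁ - f₀` is non-negative, its values on `[1 / (2 w), 1 / w]`
alone give `β` times a fixed mass, and Cauchy-Schwarz concludes. -/
lemma le_lintegral_sub_sq_of_charFun {P₀ P₁ : Measure ℝ} [IsProbabilityMeasure P₀]
    [IsProbabilityMeasure P₁] {g₀ g₁ f₀ f₁ : ℝ → ℝ} (hg₀ : Measurable g₀) (hg₁ : Measurable g₁)
    (hg₀' : ∀ x, 0 ≤ g₀ x) (hg₁' : ∀ x, 0 ≤ g₁ x)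
    (hP₀ : volume.withDensity (fun x => ENNReal.ofReal (g₀ x)) = P₀)
    (hP₁ : volume.withDensity (fun x => ENNReal.ofReal (g₁ x)) = P₁)
    (hf₀ : ∀ u, charFun P₀ u = f₀ u) (hf₁ : ∀ u, charFun P₁ u = f₁ u) (hle : ∀ u, f₀ u ≤ f₁ u)
    {w β : ℝ} (hw : 0 < w) (hβ : 0 ≤ β)
    (hsep : ∀ u ∈ Icc (1 / (2 * w)) (1 / w), β ≤ f₁ u - f₀ u) :
    ENNReal.ofReal ((β * gaussianMassBound) ^ 2 / (w * √Real.pi)) ≤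
      ∫⁻ y, ENNReal.ofReal ((g₀ y - g₁ y) ^ 2) := by
  set v : ℝ≥0 := Real.toNNReal ((w ^ 2)⁻¹) with hv
  have hvc : (v : ℝ) = (w ^ 2)⁻¹ := Real.coe_toNNReal _ (by positivity)
  let φ : ℝ → ℝ := fun x => Real.exp (-((w ^ 2)⁻¹ * x ^ 2 / 2))
  have hφm : Measurable φ := by fun_prop
  have hφ1 : ∀ x, ‖φ x‖ ≤ 1 := by
    intro x
    rw [Real.norm_eq_abs, abs_of_pos (Real.exp_pos _), Real.exp_le_one_iff, neg_nonpos]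
    positivity
  have hfi : ∀ (P : Measure ℝ) (f : ℝ → ℝ), IsProbabilityMeasure P →
      (∀ u, charFun P u = f u) → Integrable f (gaussianReal 0 v) := by
    intro P f hP hf
    have e : f = fun u => (charFun P u).re := by
      ext u
      rw [hf, Complex.ofReal_re]
    rw [e]
    refine Integrable.of_bound (C := 1) (by fun_prop) (ae_of_all _ fun u => ?_)
    exact (Complex.abs_re_le_norm _).trans (norm_charFun_le_one u)
  have hfint : ∀ (P : Measure ℝ) (f : ℝ → ℝ), IsProbabilityMeasure P →
      (∀ u, charFun P u = f u) → ∫ u, f u ∂(gaussianReal 0 v) = ∫ x, φ x ∂P := by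
    intro P f hP hf
    have := integral_charFun_gaussianReal P v
    simp_rw [hf] at this
    rw [integral_complex_ofReal, hvc] at this
    exact_mod_cast this
  have hgi : ∀ (P : Measure ℝ) (g : ℝ → ℝ), IsProbabilityMeasure P → Measurable g →
      (∀ x, 0 ≤ g x) → volume.withDensity (fun x => ENNReal.ofReal (g x)) = P →
      Integrable g := by
    intro P g hP hg hg' he
    refine ⟨hg.aestronglyMeasurable, ?_⟩
    rw [hasFiniteIntegral_iff_ofReal (ae_of_all _ hg')]
    have := hP.measure_univ
    rw [← he, withDensity_apply _ MeasurableSet.univ, Measure.restrict_univ] at this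
    rw [this]
    exact ENNReal.one_lt_top
  have hgint : ∀ (P : Measure ℝ) (g : ℝ → ℝ), Measurable g → (∀ x, 0 ≤ g x) →
      volume.withDensity (fun x => ENNReal.ofReal (g x)) = P →
      ∫ x, φ x ∂P = ∫ x, g x * φ x := by
    intro P g hg hg' he
    rw [← he, integral_withDensity_eq_integral_toReal_smul (by fun_prop) (by simp)]
    simp [hg']
  have hi₀ := hgi P₀ g₀ inferInstance hg₀ hg₀' hP₀
  have hi₁ := hgi P₁ g₁ inferInstance hg₁ hg₁' hP₁
  have hF₀ := hfi P₀ f₀ inferInstance hf₀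
  have hF₁ := hfi P₁ f₁ inferInstance hf₁
  have hB : β * gaussianMassBound ≤ ∫ x, (g₁ x - g₀ x) * φ x := by
    have e1 : ∫ x, (g₁ x - g₀ x) * φ x = ∫ u, (f₁ u - f₀ u) ∂(gaussianReal 0 v) := by
      simp_rw [sub_mul]
      rw [integral_sub (hi₁.mul_bdd (c := 1) hφm.aestronglyMeasurable (ae_of_all _ hφ1))
        (hi₀.mul_bdd (c := 1) hφm.aestronglyMeasurable (ae_of_all _ hφ1)),
        ← hgint P₀ g₀ hg₀ hg₀' hP₀, ← hgint P₁ g₁ hg₁ hg₁' hP₁,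
        ← hfint P₀ f₀ inferInstance hf₀, ← hfint P₁ f₁ inferInstance hf₁, integral_sub hF₁ hF₀]
    rw [e1]
    calc β * gaussianMassBound
        ≤ β * (gaussianReal 0 v).real (Icc (1 / (2 * w)) (1 / w)) := by
          gcongr
          exact gaussianMassBound_le hw
      _ = ∫ _ in Icc (1 / (2 * w)) (1 / w), β ∂(gaussianReal 0 v) := by
          rw [setIntegral_const, smul_eq_mul, mul_comm]
      _ ≤ ∫ u in Icc (1 / (2 * w)) (1 / w), (f₁ u - f₀ u) ∂(gaussianReal 0 v) :=
          setIntegral_mono_on (integrableOn_const (by simp)) (hF₁.sub hF₀).integrableOn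
            measurableSet_Icc hsep
      _ ≤ _ := setIntegral_le_integral (hF₁.sub hF₀)
          (ae_of_all _ fun u => sub_nonneg.2 (hle u))
  by_cases hD : ∫⁻ y, ENNReal.ofReal ((g₀ y - g₁ y) ^ 2) = ∞
  · rw [hD]
    exact le_top
  have hsq : Integrable fun y => (g₁ y - g₀ y) ^ 2 := by
    refine ⟨by fun_prop, ?_⟩
    rw [hasFiniteIntegral_iff_ofReal (ae_of_all _ fun x => sq_nonneg _)]
    have e : ∀ y, (g₁ y - g₀ y) ^ 2 = (g₀ y - g₁ y) ^ 2 := fun y => by ring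
    simp_rw [e]
    exact lt_top_iff_ne_top.2 hD
  have hφsq : Integrable fun x => φ x ^ 2 := by
    by_contra hn
    have h1 := integral_sq_gaussian hw
    rw [integral_undef hn] at h1
    have : 0 < w * √Real.pi := by positivity
    linarith
  have hcross : Integrable fun x => (g₁ x - g₀ x) * φ x :=
    (hi₁.sub hi₀).mul_bdd (c := 1) hφm.aestronglyMeasurable (ae_of_all _ hφ1)
  set B := ∫ x, (g₁ x - g₀ x) * φ x with hBdef
  have hΦ : 0 < w * √Real.pi := by positivity
  set Φ := w * √Real.pi with hΦdef
  -- Cauchy-Schwarz, from the square of `g₁ - g₀` minus its projection `(B / Φ) φ`.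
  have hCS : B ^ 2 / Φ ≤ ∫ x, (g₁ x - g₀ x) ^ 2 := by
    have h1 : 0 ≤ ∫ x, ((g₁ x - g₀ x) ^ 2 - (2 * (B / Φ) * ((g₁ x - g₀ x) * φ x) -
        (B / Φ) ^ 2 * φ x ^ 2)) := by
      refine integral_nonneg fun x => ?_
      have : (g₁ x - g₀ x) ^ 2 - (2 * (B / Φ) * ((g₁ x - g₀ x) * φ x) -
        (B / Φ) ^ 2 * φ x ^ 2) = (g₁ x - g₀ x - B / Φ * φ x) ^ 2 := by ring
      simp only [this]
      exact sq_nonneg _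
    have i1 : Integrable fun x => 2 * (B / Φ) * ((g₁ x - g₀ x) * φ x) - (B / Φ) ^ 2 * φ x ^ 2 :=
      (hcross.const_mul _).sub (hφsq.const_mul _)
    rw [integral_sub hsq i1, integral_sub (hcross.const_mul _) (hφsq.const_mul _), integral_const_mul,
      integral_const_mul, integral_sq_gaussian hw, ← hBdef, ← hΦdef] at h1
    have e : 2 * (B / Φ) * B - (B / Φ) ^ 2 * Φ = B ^ 2 / Φ := by
      field_simp
      ring
    linarith
  have hfin : ∫⁻ y, ENNReal.ofReal ((g₀ y - g₁ y) ^ 2) =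
      ENNReal.ofReal (∫ x, (g₁ x - g₀ x) ^ 2) := by
    rw [ofReal_integral_eq_lintegral_ofReal hsq (ae_of_all _ fun x => sq_nonneg _)]
    refine lintegral_congr fun y => ?_
    congr 1
    ring
  rw [hfin]
  refine ENNReal.ofReal_le_ofReal (le_trans ?_ hCS)
  have := gaussianMassBound_pos
  gcongr

/-! ### The two hypotheses -/

/-- A symmetric Lévy measure with jumps in `[-ε, ε]` that dominates the stable Lévy measure, scaled
by the sampling step, gives an admissible model. -/
lemma exists_model {J : Measure ℝ} (hJ : IsSymmJump J) {α A ε Δ M : ℝ} (hα : 0 < α) (hα' : α < 2)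
    (hA : 0 < A) (hε : 0 < ε) (hΔ : 0 < Δ) (hM : M ≤ 2 * A / (2 - α))
    (hle : symmetrize (stableJump (Δ * A) α ε) ≤ J) (hsupp : J (Icc (-ε) ε)ᶜ = 0) :
    ∃ (ν P : Measure ℝ) (g : ℝ → ℝ), ν ∈ OreyClass ε M α ∧ largeJumpMeasure ε ν = 0 ∧
      IsIncrementLaw ν Δ P ∧ IsSmallJumpDensity ε ν Δ g ∧
      volume.withDensity (fun x => ENNReal.ofReal (g x)) = P ∧
      ∀ u : ℝ, charFun P u = Complex.exp ((∫ x, (Real.cos (u * x) - 1) ∂J : ℝ) : ℂ) := by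
  have hD : 0 < Δ * A := by positivity
  have hinf : J univ = ∞ := by
    rw [← top_le_iff, ← stableJump_univ hD hα hε]
    exact ((le_symmetrize _).trans hle) univ
  obtain ⟨P, hP, hc⟩ := hJ.exists_law
  obtain ⟨g, hg, hg0, hgP⟩ := exists_real_density (hJ.law_absolutelyContinuous hinf hc)
  -- `J` describes the jumps over a whole time step, so the Lévy measure of the process is `Δ⁻¹ J`.
  set c : ℝ≥0 := Real.toNNReal Δ⁻¹ with hcdef
  have hcr : (c : ℝ) = Δ⁻¹ := Real.coe_toNNReal _ (by positivity)
  have hc0 : c ≠ 0 := by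
    intro h
    rw [h] at hcr
    have : (0 : ℝ) < Δ⁻¹ := by positivity
    rw [← hcr] at this
    simp at this
  have hν := hJ.smul c
  have hνinf : (c • J) univ = ∞ := by
    rw [Measure.smul_apply, hinf]
    exact ENNReal.mul_top (by exact_mod_cast hc0)
  have hνsupp : (c • J) (Icc (-ε) ε)ᶜ = 0 := by
    rw [Measure.smul_apply, hsupp, smul_zero]
  have hνc : ∀ u : ℝ, charFun P u =
      Complex.exp ((Δ * ∫ x, (Real.cos (u * x) - 1) ∂(c • J) : ℝ) : ℂ) := by
    intro u
    rw [hc, integral_smul_nnreal_measure, NNReal.smul_def, hcr, smul_eq_mul, ← mul_assoc,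
      mul_inv_cancel₀ hΔ.ne', one_mul]
  refine ⟨c • J, P, g, hν.mem_oreyClass hνinf fun η hη hηε => ?_, ?_, hν.isIncrementLaw hνc,
    hν.isSmallJumpDensity hνsupp hνc hg hg0 hgP, hgP, hc⟩
  · have h2α : 0 < 2 - α := by linarith
    have h1 : ∫⁻ x in Icc (-η) η, ENNReal.ofReal (x ^ 2) ∂(symmetrize (stableJump (Δ * A) α ε)) ≤
        ∫⁻ x in Icc (-η) η, ENNReal.ofReal (x ^ 2) ∂J :=
      lintegral_mono' (Measure.restrict_mono le_rfl hle) le_rfl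
    rw [setLIntegral_sq_symmetrize, setLIntegral_sq_stableJump hD hα' hη hηε] at h1
    rw [Measure.restrict_smul, lintegral_smul_measure]
    calc ENNReal.ofReal (M * η ^ (2 - α))
        ≤ ENNReal.ofReal (c * (2 * (Δ * A * η ^ (2 - α) / (2 - α)))) := by
          refine ENNReal.ofReal_le_ofReal ?_
          have e : (c : ℝ) * (2 * (Δ * A * η ^ (2 - α) / (2 - α))) =
              2 * A / (2 - α) * η ^ (2 - α) := by
            rw [hcr]
            field_simp
          rw [e]
          gcongr
      _ = c * (2 * ENNReal.ofReal (Δ * A * η ^ (2 - α) / (2 - α))) := by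
          rw [ENNReal.ofReal_mul c.coe_nonneg, ENNReal.ofReal_mul zero_le_two, ENNReal.ofReal_coe_nnreal,
            ENNReal.ofReal_ofNat]
      _ ≤ c • ∫⁻ x in Icc (-η) η, ENNReal.ofReal (x ^ 2) ∂J := by
          rw [ENNReal.smul_def, smul_eq_mul]
          gcongr
  · rw [largeJumpMeasure, Measure.restrict_eq_zero]
    exact hνsupp

/-- The scale `h` of the perturbation, the mean number `N` of jumps at that scale, and the width
`√N * h` of the density. -/
lemma exists_scale {α ε Δ : ℝ} (hα : 0 < α) (hα' : α < 2) (hε : 0 < ε) (hΔ : 0 < Δ) :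
    ∃ h N w : ℝ, 0 < h ∧ h ≤ ε ∧ 1 ≤ N ∧ 0 < w ∧ w ^ 2 = N * h ^ 2 ∧ w ≤ Δ ^ (1 / α) ∧
      Δ * h ^ (2 - α) = w ^ 2 ∧
      ∀ A, 0 < A → stableJump (Δ * A) α ε (Ioi h) ≤ ENNReal.ofReal (A / α) := by
  -- `Δ ^ (1 / α)` is the natural size of a stable increment, capped at the largest allowed jump.
  -- With `N = Δ / h ^ α`, the variance `N h ^ 2 = Δ h ^ (2 - α)` has the order of that of the
  -- stable jumps up to `h`.
  set h := min ε (Δ ^ (1 / α)) with hdef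
  have hΔp : 0 < Δ ^ (1 / α) := by positivity
  have hh : 0 < h := lt_min hε hΔp
  have hle : h ≤ Δ ^ (1 / α) := min_le_right _ _
  have hpow : (Δ ^ (1 / α)) ^ α = Δ := by
    rw [← Real.rpow_mul hΔ.le, one_div_mul_cancel hα.ne', Real.rpow_one]
  have hhα : h ^ α ≤ Δ := by
    calc h ^ α ≤ (Δ ^ (1 / α)) ^ α := by gcongr
      _ = Δ := hpow
  have hN : 1 ≤ Δ / h ^ α := by
    rw [le_div_iff₀ (by positivity), one_mul]
    exact hhα
  have hN0 : 0 < Δ / h ^ α := by positivity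
  have hw2 : (√(Δ / h ^ α) * h) ^ 2 = Δ / h ^ α * h ^ 2 := by
    rw [mul_pow, Real.sq_sqrt hN0.le]
  have hsub : h ^ (2 - α) = h ^ 2 / h ^ α := by
    rw [Real.rpow_sub hh, Real.rpow_ofNat]
  have hw2' : Δ * h ^ (2 - α) = (√(Δ / h ^ α) * h) ^ 2 := by
    rw [hw2, hsub]
    ring
  refine ⟨h, Δ / h ^ α, √(Δ / h ^ α) * h, hh, min_le_left _ _, hN, by positivity, hw2, ?_, hw2',
    fun A hA => ?_⟩
  · refine (pow_le_pow_iff_left₀ (by positivity) hΔp.le two_ne_zero).1 ?_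
    rw [← hw2']
    calc Δ * h ^ (2 - α) ≤ Δ * (Δ ^ (1 / α)) ^ (2 - α) := by
          have : 0 ≤ 2 - α := by linarith
          gcongr
      _ = (Δ ^ (1 / α)) ^ 2 := by
          nth_rewrite 1 [← hpow]
          rw [← Real.rpow_add hΔp, add_sub_cancel, Real.rpow_ofNat]
  -- If `h = ε` there are no stable jumps above `h`. Otherwise `Δ h ^ (-α) = 1`, and their mass is
  -- at most `A / α`.
  · rcases le_total ε (Δ ^ (1 / α)) with hc | hc
    · have he : h = ε := min_eq_left hc
      have : stableJump (Δ * A) α ε (Ioi h) = 0 := by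
        refine measure_mono_null (fun x hx => ?_) stableJump_compl
        rw [he] at hx
        exact fun h2 => not_le.2 hx h2.2
      rw [this]
      exact zero_le
    · have he : h = Δ ^ (1 / α) := min_eq_right hc
      refine (stableJump_Ioi_le (by positivity) hα hh).trans (ENNReal.ofReal_le_ofReal ?_)
      rw [Real.rpow_neg hh.le, he, hpow]
      refine le_of_eq ?_
      field_simp

/-- The two hypotheses: models in the Orey class with the same large jumps, at `χ²`-distance
of order `δ ^ 2`, and with characteristic functions that differ by a multiple of `δ` at the
frequencies of order `1 / w`. -/
lemma exists_two_models {α A ε Δ M δ : ℝ} (hα : 0 < α) (hα' : α < 2) (hA : 0 < A) (hε : 0 < ε)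
    (hΔ : 0 < Δ) (hM : M ≤ 2 * A / (2 - α)) (hδ : 0 < δ) (hδ' : δ < 1) :
    ∃ (w : ℝ) (ν₀ ν₁ P₀ P₁ : Measure ℝ) (g₀ g₁ f₀ f₁ h : ℝ → ℝ), 0 < w ∧ w ≤ Δ ^ (1 / α) ∧
      ν₀ ∈ OreyClass ε M α ∧ ν₁ ∈ OreyClass ε M α ∧
      largeJumpMeasure ε ν₀ = largeJumpMeasure ε ν₁ ∧
      IsIncrementLaw ν₀ Δ P₀ ∧ IsIncrementLaw ν₁ Δ P₁ ∧
      IsSmallJumpDensity ε ν₀ Δ g₀ ∧ IsSmallJumpDensity ε ν₁ Δ g₁ ∧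
      volume.withDensity (fun x => ENNReal.ofReal (g₀ x)) = P₀ ∧
      volume.withDensity (fun x => ENNReal.ofReal (g₁ x)) = P₁ ∧
      (Measurable h ∧ (∀ x, 0 ≤ h x) ∧ P₁ = P₀.withDensity (fun x => ENNReal.ofReal (h x)) ∧
        ∫⁻ x, ENNReal.ofReal ((h x - 1) ^ 2) ∂P₀ ≤ ENNReal.ofReal ((δ / (1 - δ)) ^ 2)) ∧
      (∀ u, charFun P₀ u = f₀ u) ∧ (∀ u, charFun P₁ u = f₁ u) ∧ (∀ u, f₀ u ≤ f₁ u) ∧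
      ∀ u ∈ Icc (1 / (2 * w)) (1 / w),
        Real.exp (-(A / (2 - α) + 4 * (A / α) + 1)) * (δ / (4 * Real.pi ^ 2)) ≤ f₁ u - f₀ u := by
  obtain ⟨h, N, w, hh, hhε, hN, hw, hw2, hwΔ, hΔh, htail⟩ := exists_scale hα hα' hε hΔ
  have hN0 : 0 < N := by linarith
  have hD : 0 < Δ * A := by positivity
  have h2α : 0 < 2 - α := by linarith
  lift N to ℝ≥0 using hN0.le with r
  have hr : 0 < r := by exact_mod_cast hN0
  set s : ℝ≥0 := Real.toNNReal (δ * r) with hsdef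
  have hs : (s : ℝ) = δ * r := Real.coe_toNNReal _ (by positivity)
  set t : ℝ≥0 := Real.toNNReal ((1 - δ) * r) with htdef
  have ht : (t : ℝ) = (1 - δ) * r :=
    Real.coe_toNNReal _ (mul_nonneg (by linarith) r.2)
  set σ := stableJump (Δ * A) α ε with hσ
  set U := uniformJump h with hU
  have hUp : IsProbabilityMeasure U := isProbabilityMeasure_uniformJump hh
  have hUae : ∀ᵐ x ∂U, x ∈ Icc 0 h := by
    filter_upwards [ae_mem_uniformJump (h := h)] with x hx
    exact ⟨by linarith [hx.1], hx.2⟩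
  have hσJ : IsSymmJump (symmetrize σ) := isSymmJump_symmetrize stableJump_absolutelyContinuous
    (lintegral_sq_stableJump_lt_top hD hα' hε)
  have hUJ : IsSymmJump (symmetrize U) := isSymmJump_symmetrize uniformJump_absolutelyContinuous
    (lintegral_sq_lt_top_of_compl_Icc (uniformJump_compl_Icc hh hhε))
  have hVJ : IsSymmJump (selfDifference U) :=
    isSymmJump_selfDifference hUae uniformJump_absolutelyContinuous
  have hσs : symmetrize σ (Icc (-ε) ε)ᶜ = 0 := by
    have hsub : Ioc 0 ε ⊆ Icc (-ε) ε := fun x hx => ⟨by linarith [hx.1], hx.2⟩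
    exact symmetrize_compl_Icc (measure_mono_null (compl_subset_compl.2 hsub) stableJump_compl)
  have hUs : symmetrize U (Icc (-ε) ε)ᶜ = 0 :=
    symmetrize_compl_Icc (uniformJump_compl_Icc hh hhε)
  have hVs : selfDifference U (Icc (-ε) ε)ᶜ = 0 := by
    refine measure_mono_null (compl_subset_compl.2 (Icc_subset_Icc ?_ hhε))
      (selfDifference_compl_Icc hUae)
    linarith
  -- The perturbation takes mass from `r • symmetrize U` only, so both measures dominate the stable
  -- part.
  have hJ₀ : IsSymmJump (symmetrize σ + r • symmetrize U) := hσJ.add (hUJ.smul r)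
  have hJ₁ : IsSymmJump (symmetrize σ + (t • symmetrize U + s • selfDifference U)) :=
    hσJ.add ((hUJ.smul t).add (hVJ.smul s))
  obtain ⟨ν₀, P₀, g₀, hν₀, hl₀, hP₀, hg₀, hgP₀, hc₀⟩ := exists_model hJ₀ hα hα' hA hε hΔ hM
    (Measure.le_add_right le_rfl) (by simp [hσs, hUs])
  obtain ⟨ν₁, P₁, g₁, hν₁, hl₁, hP₁, hg₁, hgP₁, hc₁⟩ := exists_model hJ₁ hα hα' hA hε hΔ hM
    (Measure.le_add_right le_rfl) (by simp [hσs, hUs, hVs])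
  have hp₀ := hP₀.isProbabilityMeasure
  have hp₁ := hP₁.isProbabilityMeasure
  obtain ⟨R, hR, hcR⟩ := hσJ.exists_law
  let E : ℝ → ℝ := fun u => ∫ x, (Real.cos (u * x) - 1) ∂(symmetrize σ)
  let c : ℝ → ℂ := charFun U
  have hI₀ : ∀ u, ∫ x, (Real.cos (u * x) - 1) ∂(symmetrize σ + r • symmetrize U) =
      E u + r * (2 * ((c u).re - 1)) := by
    intro u
    rw [integral_add_measure (hσJ.integrable_cos_sub_one u) ((hUJ.smul r).integrable_cos_sub_one u),
      integral_smul_nnreal_measure, integral_symmetrize u hUJ, integral_cos_sub_one U u,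
      NNReal.smul_def, smul_eq_mul]
  -- Merging pairs of opposite jumps at rate `δ r` changes the exponent by `δ r (|c| ^ 2 - 2 Re c +
  -- 1) = δ r |c - 1| ^ 2`.
  have hI₁ : ∀ u, ∫ x, (Real.cos (u * x) - 1)
      ∂(symmetrize σ + (t • symmetrize U + s • selfDifference U)) =
      E u + r * (2 * ((c u).re - 1)) + δ * r * Complex.normSq (c u - 1) := by
    intro u
    rw [integral_add_measure (hσJ.integrable_cos_sub_one u)
      (((hUJ.smul t).add (hVJ.smul s)).integrable_cos_sub_one u),
      integral_add_measure ((hUJ.smul t).integrable_cos_sub_one u)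
      ((hVJ.smul s).integrable_cos_sub_one u),
      integral_smul_nnreal_measure, integral_smul_nnreal_measure, integral_symmetrize u hUJ,
      integral_cos_sub_one U u, integral_cos_sub_one (selfDifference U) u,
      charFun_selfDifference, Complex.ofReal_re, NNReal.smul_def, NNReal.smul_def, smul_eq_mul,
      smul_eq_mul, hs, ht, Complex.normSq_apply, Complex.normSq_apply]
    simp only [Complex.sub_re, Complex.sub_im, Complex.one_re, Complex.one_im, c, E]
    ring
  let f₀ : ℝ → ℝ := fun u => Real.exp (E u + r * (2 * ((c u).re - 1)))
  let f₁ : ℝ → ℝ := fun u => f₀ u * Real.exp (δ * r * Complex.normSq (c u - 1))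
  have hf₀ : ∀ u, charFun P₀ u = f₀ u := by
    intro u
    rw [hc₀, hI₀, Complex.ofReal_exp]
  have hf₁ : ∀ u, charFun P₁ u = f₁ u := by
    intro u
    rw [hc₁, hI₁, ← Complex.ofReal_exp, Real.exp_add]
  have hχ := exists_density_of_correlated_jumps hr hδ hδ' U (U.map fun x => -x) R P₀ P₁
    (fun u => by
      rw [hf₀, hcR, charFun_map_neg, ← Complex.exp_add, ← Complex.exp_add, Complex.ofReal_exp]
      congr 1
      have := Complex.add_conj (charFun U u)
      simp only [E, c]
      push_cast
      push_cast at this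
      linear_combination -(r : ℂ) * this)
    (fun u => by
      rw [hf₁, hf₀, charFun_map_neg, Complex.ofReal_mul]
      congr 1
      rw [Complex.ofReal_exp]
      congr 1
      push_cast
      rw [← Complex.mul_conj, map_sub, map_one]
      ring)
  obtain ⟨L, hL⟩ := hχ
  have hle : ∀ u, f₀ u ≤ f₁ u := by
    intro u
    refine le_mul_of_one_le_right (Real.exp_pos _).le ?_
    rw [Real.one_le_exp_iff]
    have := Complex.normSq_nonneg (c u - 1)
    positivity
  refine ⟨w, ν₀, ν₁, P₀, P₁, g₀, g₁, f₀, f₁, L, hw, hwΔ, hν₀, hν₁, by rw [hl₀, hl₁], hP₀, hP₁,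
    hg₀, hg₁, hgP₀, hgP₁, hL, hf₀, hf₁, hle, fun u hu => ?_⟩
  have hu0 : 0 < u := lt_of_lt_of_le (by positivity) hu.1
  have huw : u * w ≤ 1 := (le_div_iff₀ hw).1 hu.2
  have huw' : 1 ≤ 2 * (u * w) := by
    have := (div_le_iff₀ (by positivity : 0 < 2 * w)).1 hu.1
    linarith
  have hsq1 : u ^ 2 * w ^ 2 ≤ 1 := by
    rw [← mul_pow]
    exact pow_le_one₀ (by positivity) huw
  have hsq2 : 1 / 4 ≤ u ^ 2 * w ^ 2 := by
    rw [← mul_pow]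
    nlinarith
  have hhw : h ≤ w := by
    refine (pow_le_pow_iff_left₀ hh.le hw.le two_ne_zero).1 ?_
    rw [hw2]
    exact le_mul_of_one_le_left (sq_nonneg _) hN
  -- At frequencies up to `1 / w` the stable jumps below `h` contribute through `u ^ 2 w ^ 2 ≤ 1`,
  -- those above through their mass; symmetrisation doubles both.
  have hE : -(A / (2 - α) + 4 * (A / α)) ≤ E u := by
    have h1 := integral_one_sub_cos_stableJump_le hD hα' hh hhε
      (by positivity : 0 ≤ A / α) (htail A hA) u
    have h2 : E u = -(2 * ∫ x, (1 - Real.cos (u * x)) ∂σ) := by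
      simp only [E]
      rw [integral_symmetrize u hσJ, ← mul_neg, ← integral_neg]
      simp only [neg_sub]
    have h3 : u ^ 2 / 2 * (Δ * A * h ^ (2 - α) / (2 - α)) =
        (u ^ 2 * w ^ 2) * (A / (2 - α)) / 2 := by
      rw [← hΔh]
      ring
    have h4 : (u ^ 2 * w ^ 2) * (A / (2 - α)) ≤ A / (2 - α) :=
      mul_le_of_le_one_left (by positivity) hsq1
    rw [h2]
    rw [h3] at h1
    linarith
  have hc1 : -1 ≤ r * (2 * ((c u).re - 1)) := by
    have h1 := integral_one_sub_cos_uniformJump_le hh u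
    have h2 : (r : ℝ) * (u ^ 2 * h ^ 2) ≤ 1 := by
      refine le_trans (le_of_eq ?_) hsq1
      rw [hw2]
      ring
    have h3 : (r : ℝ) * (2 * (1 - (c u).re)) ≤ r * (2 * (u ^ 2 * h ^ 2 / 2)) := by
      simp only [c]
      gcongr
    linarith
  -- The imaginary part gives `|c u - 1| ≥ u h / π`; then `r h ^ 2 = w ^ 2` and `u ^ 2 w ^ 2 ≥ 1 /
  -- 4`.
  have hc2 : δ / (4 * Real.pi ^ 2) ≤ δ * r * Complex.normSq (c u - 1) := by
    have h1 := le_charFun_uniformJump_im hh hu0.le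
      (le_trans (mul_le_mul_of_nonneg_left hhw hu0.le) huw)
    have h2 : (u * h / Real.pi) ^ 2 ≤ Complex.normSq (c u - 1) := by
      rw [Complex.normSq_apply]
      simp only [Complex.sub_im, Complex.one_im, sub_zero, c]
      have : (u * h / Real.pi) ^ 2 ≤ (charFun U u).im ^ 2 := by
        have := Real.pi_pos
        gcongr
      nlinarith [mul_self_nonneg (charFun U u - 1).re]
    calc δ / (4 * Real.pi ^ 2) = δ * (1 / 4) / Real.pi ^ 2 := by ring
      _ ≤ δ * (u ^ 2 * w ^ 2) / Real.pi ^ 2 := by gcongr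
      _ = δ * r * (u * h / Real.pi) ^ 2 := by rw [hw2]; ring
      _ ≤ _ := by gcongr
  have hexp : Real.exp (-(A / (2 - α) + 4 * (A / α) + 1)) ≤ f₀ u := by
    refine Real.exp_le_exp.2 ?_
    linarith
  have hexp2 := Real.add_one_le_exp (δ * r * Complex.normSq (c u - 1))
  calc Real.exp (-(A / (2 - α) + 4 * (A / α) + 1)) * (δ / (4 * Real.pi ^ 2))
      ≤ f₀ u * (Real.exp (δ * r * Complex.normSq (c u - 1)) - 1) := by
        gcongr
        linarith
    _ = f₁ u - f₀ u := by simp only [f₁]; ring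

/-- For `δ = 1 / (4 √n)`, `δ / (1 - δ) = 1 / (4 √n - 1) ≤ 1 / (3 √n)`, so the power is at most `exp
(1 / 9)`, and `e ≤ (5 / 4) ^ 9`. -/
lemma one_add_chiSq_pow_le {n : ℕ} (hn : 0 < n) :
    (1 + (1 / (4 * √n) / (1 - 1 / (4 * √n))) ^ 2) ^ n ≤ 5 / 4 := by
  have hn1 : (1 : ℝ) ≤ n := by exact_mod_cast hn
  have hs1 : 1 ≤ √(n : ℝ) := Real.one_le_sqrt.2 hn1
  have hs0 : 0 < √(n : ℝ) := by linarith
  have h1 : 1 / (4 * √(n : ℝ)) / (1 - 1 / (4 * √n)) ≤ 1 / (3 * √n) := by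
    have e : 1 / (4 * √(n : ℝ)) / (1 - 1 / (4 * √n)) = 1 / (4 * √n - 1) := by
      have : 4 * √(n : ℝ) - 1 ≠ 0 := by linarith
      field_simp
    rw [e]
    exact one_div_le_one_div_of_le (by positivity) (by linarith)
  have h0 : 0 ≤ 1 / (4 * √(n : ℝ)) / (1 - 1 / (4 * √n)) := by
    have : 1 / (4 * √(n : ℝ)) ≤ 1 := by
      rw [div_le_one (by positivity)]
      linarith
    exact div_nonneg (by positivity) (by linarith)
  have h2 : (1 / (4 * √(n : ℝ)) / (1 - 1 / (4 * √n))) ^ 2 ≤ 1 / (9 * n) := by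
    calc _ ≤ (1 / (3 * √(n : ℝ))) ^ 2 := by gcongr
      _ = 1 / (9 * n) := by
        rw [div_pow, mul_pow, Real.sq_sqrt (by positivity)]
        norm_num
  have hexp : Real.exp (1 / 9) ≤ 5 / 4 := by
    have h3 : Real.exp (1 / 9) ^ 9 ≤ (5 / 4 : ℝ) ^ 9 := by
      rw [← Real.exp_nat_mul]
      norm_num
      have := Real.exp_one_lt_d9
      linarith
    exact le_of_pow_le_pow_left₀ (by norm_num) (by norm_num) h3
  calc (1 + (1 / (4 * √(n : ℝ)) / (1 - 1 / (4 * √n))) ^ 2) ^ n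
      ≤ (Real.exp (1 / (9 * n))) ^ n := by
        refine pow_le_pow_left₀ (by positivity) ?_ n
        have := Real.add_one_le_exp (1 / (9 * (n : ℝ)))
        linarith
    _ = Real.exp (1 / 9) := by
        rw [← Real.exp_nat_mul]
        congr 1
        field_simp
    _ ≤ 5 / 4 := hexp

end

/-! ### The minimax lower bound -/

theorem theorem3 (α₀ : ℝ) (hα₀ : 0 < α₀) (hα₀' : α₀ < 2) :
    ∃ c₀ : ℝ, 0 < c₀ ∧ ∃ K : ℝ, 0 < K ∧
      ∀ M : ℝ, 0 < M → M ≤ stableConst α₀ →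
      ∀ ε : ℝ, 0 < ε → ε ≤ 1 →
      ∀ Δ : ℝ, 0 < Δ → Δ < Real.exp (-4 / (2 - α₀)) →
      ∀ n : ℕ, K ≤ (n : ℝ) * Real.log Δ ^ 2 →
        ENNReal.ofReal (c₀ / ((n : ℝ) * Δ ^ (1 / α₀))) ≤ minimaxRisk n Δ ε M α₀ := by
  have h2α : 0 < 2 - α₀ := by linarith
  -- One stable intensity serves all `M ≤ stableConst α₀`, so the constants do not depend on `M`.
  -- The maximum with `1` makes `A` positive without a discussion of the sign of `stableConst α₀`.
  set A : ℝ := max (stableConst α₀) 1 * (2 - α₀) / 2 with hAdef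
  have hA : 0 < A := by
    have : 0 < max (stableConst α₀) 1 := lt_max_of_lt_right one_pos
    positivity
  have hAM : 2 * A / (2 - α₀) = max (stableConst α₀) 1 := by
    rw [hAdef]
    field_simp
  set B : ℝ := Real.exp (-(A / (2 - α₀) + 4 * (A / α₀) + 1)) with hBdef
  have hB : 0 < B := Real.exp_pos _
  have hG := gaussianMassBound_pos
  have hpi := Real.pi_pos
  refine ⟨(B / (16 * Real.pi ^ 2) * gaussianMassBound) ^ 2 / √Real.pi / 8, by positivity, 1,
    one_pos, fun M _ hMF ε hε _ Δ hΔ _ n hK => ?_⟩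
  -- The condition with `K = 1` serves to exclude `n = 0`.
  have hn : 0 < n := by
    rcases Nat.eq_zero_or_pos n with rfl | h
    · norm_num at hK
    · exact h
  have hnr : (0 : ℝ) < n := by exact_mod_cast hn
  have hs1 : 1 ≤ √(n : ℝ) := Real.one_le_sqrt.2 (by exact_mod_cast hn)
  have hs0 : 0 < √(n : ℝ) := by linarith
  -- The largest order of perturbation that `n` observations cannot detect; `δ ^ 2 = 1 / (16 n)`
  -- turns the factor `4 π ^ 2` of the separation into `16 π ^ 2`.
  set δ : ℝ := 1 / (4 * √n) with hδdef
  have hδ : 0 < δ := by positivity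
  have hδ' : δ < 1 := by
    rw [hδdef, div_lt_one (by positivity)]
    linarith
  obtain ⟨w, ν₀, ν₁, P₀, P₁, g₀, g₁, f₀, f₁, h, hw, hwΔ, hν₀, hν₁, hl, hP₀, hP₁, hg₀, hg₁, hgP₀,
    hgP₁, ⟨hm, h0, hd, hχ⟩, hf₀, hf₁, hle, hsep⟩ := exists_two_models (M := M) hα₀ hα₀' hA hε hΔ
      (hAM ▸ hMF.trans (le_max_left _ _)) hδ hδ'
  have hp₀ := hP₀.isProbabilityMeasure
  have hp₁ := hP₁.isProbabilityMeasure
  have hlow := le_lintegral_sub_sq_of_charFun hg₀.measurable hg₁.measurable hg₀.nonneg hg₁.nonneg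
    hgP₀ hgP₁ hf₀ hf₁ hle hw (by positivity) hsep
  have hrisk := le_minimaxRisk_of_two_points hν₀ hν₁ hl hP₀ hP₁ hg₀ hg₁ hm h0 (sq_nonneg _) hd hχ
    (one_add_chiSq_pow_le hn)
  refine le_trans ?_ hrisk
  refine le_trans ?_ (ENNReal.div_le_div_right hlow 8)
  have h8 : (8 : ℝ≥0∞) = ENNReal.ofReal 8 := by simp
  rw [h8, ← ENNReal.ofReal_div_of_pos (by norm_num)]
  refine ENNReal.ofReal_le_ofReal ?_
  have e : (B / (16 * Real.pi ^ 2) * gaussianMassBound) ^ 2 / √Real.pi / 8 /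
      (n * Δ ^ (1 / α₀)) = (B * (δ / (4 * Real.pi ^ 2)) * gaussianMassBound) ^ 2 /
        (Δ ^ (1 / α₀) * √Real.pi) / 8 := by
    have hδ2 : δ ^ 2 = 1 / (16 * n) := by
      rw [hδdef, div_pow, mul_pow, Real.sq_sqrt hnr.le]
      norm_num
    have h1 : (B * (δ / (4 * Real.pi ^ 2)) * gaussianMassBound) ^ 2 =
        δ ^ 2 * (B / (4 * Real.pi ^ 2) * gaussianMassBound) ^ 2 := by ring
    rw [h1, hδ2]
    have hΔp : Δ ^ (1 / α₀) ≠ 0 := (Real.rpow_pos_of_pos hΔ _).ne'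
    field_simp
    ring
  rw [e]
  gcongr
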